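/- **Setting.** Complexity classes are those of the polynomial hierarchy: $\Sigma_0^P=\mathcal P$, and $\Sigma_{k+1}^P$ consists of the problems solvable in nondeterministic polynomial time (i.e. with polynomial-length certificates verifiable in deterministic polynomial time) with oracles for problems in $\Sigma_k^P$. A minimization problem is said to be in a class if the class contains its decision problem: given an instance and a rational bound $\gamma$, is there a feasible solution with objective value at most $\gamma$? Rational numbers are encoded as fractions of binary integers. Let $s\ge 1$ and $r\ge 0$. Consider a class of multilevel problems with $s$ upper levels $\mathcal U_1,\dots,\mathcal U_s$ ($\mathcal U_1$ top-most) and one bottom level $\mathcal L$. An instance $w$ determines, for each $i\le s$, a domain $\mathcal X_{i}$ of rational vectors $x_{(i)}$, an objective $F_{(i)}(x,v)$ and constraints $G_{i,k}(x,v)\le 0$, $k=1,\dots,m_{i}$, where $x=(x_{(1)},\dots,x_{(s)})$ (the objectives may, but need not, depend on $v$); a bottom-level feasible set $\mathcal Y(x)$ of rational vectors, a bottom-level objective $f(x,y)$, and a tolerance $\delta\ge 0$. As usual, it is understood that all vectors in the domains and in $\mathcal Y(x)$ have dimension depending only on $w$ (and on the level) and size polynomial in the size of $w$, that membership in $\mathcal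 X_{i}$ is decidable in polynomial time, that $m_i$ is polynomially bounded, that $m_i,\delta,F_{(i)},G_{i,k},f$ (rational-valued) can be evaluated in polynomial time (with $k$ in unary), and that the feasibility of a given $y$ for the bottom level can be checked in polynomial time or, more generally, in polynomial time with oracles for problems in $\Sigma_r^P$. The bottom level $\mathcal L(x)$, parameterized by all upper-level decisions $x_{(i)}\in\mathcal X_i$, is $\min\{f(x,y): y\in\mathcal Y(x)\}$. For a canonical decision $v\in\arg\min_{y\in\mathcal Y(x)}f(x,y)$ put $\mathcal Z(x;\delta)=\{z\in\mathcal Y(x): f(x,z)\le f(x,v)+\delta\}$. In the *generalized near-optimal robust multilevel problem* $\mathrm{GNORMP}_s$, level $\mathcal U_i$, parameterized by $x_{(1)},\dots,x_{(i-1)}$, minimizes $F_{(i)}(x,v)$ over $(x_{(i)},\dots,x_{(s)},v)$ subject to $x_{(i)}\in\mathcal X_{i}$, to $G_{i,k}(x,v)\le 0$ and $G_{i,k}(x,z)\le 0$ for all $z\in\mathcal Z(x;\delta)$ and all $k\le m_i$, and to $(x_{(i+1)},\dots,x_{(s)},v)$ being an optimal solution of $\mathcal U_{i+1}(x_{(1)},\dots,x_{(i)})$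 (of $\mathcal L(x)$ if $i=s$); the problem to be solved is $\mathcal U_1$. The *canonical* problem is the same without the constraints $G_{i,k}(x,z)\le 0$, $z\in\mathcal Z(x;\delta)$. Let $\mathcal H$ be a family of rational-valued functions of $y$ whose members are given by codes. $\mathcal L$ is in $\Sigma_r^{P*}[\mathcal H]$ if it is in $\Sigma_r^P$ and the following problem is in $\Sigma_r^P$ as well: given $w$, $x$ with $x_{(i)}\in\mathcal X_i$ for all $i$, a linear constraint $a^\top y+c\,u\le b$ with rational data, and (a code of) $h\in\mathcal H$, minimize $h(y)$ over all $(y,u)$ with $y\in\mathcal Y(x)$, $u\in\mathbb Q$, $f(x,y)\le u$ and $a^\top y+c\,u\le b$; that is, the bottom level in epigraph form remains in $\Sigma_r^P$ with an additional linear constraint and an objective function from $\mathcal H$. **Theorem 4.** Suppose that $\mathcal L$, parameterized by all upper-level decisions, is in $\Sigma_r^{P*}[\mathcal H]$, where $\mathcal H$ contains the functions $-G_{i,k}(x,\cdot)$, restricted to $\mathcal Y(x)$, for all $i$, $k$, and all $x$ with $x_{(j)}\in\mathcal X_j$ for every $j$ (with codes computable in polynomial time from $w$, $k$ and $x$). Then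 $\mathrm{GNORMP}_s$ is in $\Sigma_{r+s}^P$, and so is the corresponding canonical multilevel problem. -/

import Mathlib

/-! ## Oracle programs with a step count -/

/-- Bit strings. -/
abbrev Str := List Bool

/-- Programs of a machine with finitely many stacks of bits (a program mentions only finitely many
of the registers `0, 1, 2, …`) and access to oracles (again finitely many of `0, 1, 2, …`). -/
inductive Prog : Type
  /-- push the bit `b` on register `r` -/
  | push (r : ℕ) (b : Bool) : Prog
  /-- remove the top bit of register `r` (no effect if it is empty) -/
  | pop (r : ℕ) : Prog
  /-- run `p`, then `q` -/
  | seq (p q : Prog) : Prog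
  /-- branch on register `r`: empty, top bit `false`, top bit `true` -/
  | case (r : ℕ) (pNil pFalse pTrue : Prog) : Prog
  /-- repeat `p` as long as register `r` is not empty -/
  | loop (r : ℕ) (p : Prog) : Prog
  /-- ask the `j`-th oracle about the content of register `r`, push the answer on register `t` -/
  | query (j r t : ℕ) : Prog

/-- The contents of all registers. -/
abbrev Store := ℕ → Str

/-- `Exec O p σ τ n`: with the oracles `O`, the program `p` started in the store `σ` halts in the
store `τ` after exactly `n` steps. Pushing, popping, testing a register and asking an oracle cost
one step each. -/
inductive Exec (O : ℕ → Set Str) : Prog → Store → Store → ℕ → Prop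
  | push (r : ℕ) (b : Bool) (σ : Store) :
      Exec O (.push r b) σ (Function.update σ r (b :: σ r)) 1
  | pop (r : ℕ) (σ : Store) :
      Exec O (.pop r) σ (Function.update σ r (σ r).tail) 1
  | seq {p q : Prog} {σ τ υ : Store} {m n : ℕ} :
      Exec O p σ τ m → Exec O q τ υ n → Exec O (.seq p q) σ υ (m + n)
  | case_nil {r : ℕ} {pNil pFalse pTrue : Prog} {σ τ : Store} {n : ℕ} :
      σ r = [] → Exec O pNil σ τ n → Exec O (.case r pNil pFalse pTrue) σ τ (n + 1)
  | case_false {r : ℕ} {pNil pFalse pTrue : Prog} {σ τ : Store} {n : ℕ} :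
      (σ r).head? = some false → Exec O pFalse σ τ n →
      Exec O (.case r pNil pFalse pTrue) σ τ (n + 1)
  | case_true {r : ℕ} {pNil pFalse pTrue : Prog} {σ τ : Store} {n : ℕ} :
      (σ r).head? = some true → Exec O pTrue σ τ n →
      Exec O (.case r pNil pFalse pTrue) σ τ (n + 1)
  | loop_done {r : ℕ} {p : Prog} {σ : Store} :
      σ r = [] → Exec O (.loop r p) σ σ 1
  | loop_step {r : ℕ} {p : Prog} {σ τ υ : Store} {m n : ℕ} :
      σ r ≠ [] → Exec O p σ τ m → Exec O (.loop r p) τ υ n →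
      Exec O (.loop r p) σ υ (m + n + 1)
  | query_yes {j r t : ℕ} {σ : Store} :
      σ r ∈ O j → Exec O (.query j r t) σ (Function.update σ t (true :: σ t)) 1
  | query_no {j r t : ℕ} {σ : Store} :
      σ r ∉ O j → Exec O (.query j r t) σ (Function.update σ t (false :: σ t)) 1

/-- The initial store: the input in register `0`, all other registers empty. -/
def initStore (u : Str) : Store := fun r => if r = 0 then u else []

/-- No oracle. -/
def noOracle : ℕ → Set Str := fun _ => ∅

/-- `L` is decided in polynomial time with the oracles `O`: the program halts on every input
within polynomially many steps, and accepts (top bit `true` in register `0`) exactly on `L`. -/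
def DecidedInPolyTime (O : ℕ → Set Str) (L : Set Str) : Prop :=
  ∃ (p : Prog) (q : Polynomial ℕ), ∀ u : Str, ∃ (τ : Store) (n : ℕ),
    Exec O p (initStore u) τ n ∧ n ≤ q.eval u.length ∧ ((τ 0).head? = some true ↔ u ∈ L)

/-! ## The polynomial hierarchy -/

/-- A self-delimiting pairing of bit strings. -/
def pairStr : Str → Str → Str
  | [], v => false :: v
  | b :: u, v => true :: b :: pairStr u v

/-- The classes `Σ_k^P`: `Σ_0^P` is `P`; the languages of `Σ_{k+1}^P` are those for which
certificates of polynomial length can be verified in polynomial time with oracles for languages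
of `Σ_k^P`. -/
def SigmaP : ℕ → Set (Set Str)
  | 0 => {L | DecidedInPolyTime noOracle L}
  | k + 1 => {L | ∃ (O : ℕ → Set Str) (V : Set Str) (q : Polynomial ℕ),
      (∀ j, O j ∈ SigmaP k) ∧ DecidedInPolyTime O V ∧
      ∀ u : Str, u ∈ L ↔ ∃ c : Str, c.length ≤ q.eval u.length ∧ pairStr u c ∈ V}

/-- Languages decidable in polynomial time with oracles for languages of `Σ_k^P`. -/
def PWithSigmaOracle (k : ℕ) : Set (Set Str) :=
  {L | ∃ O : ℕ → Set Str, (∀ j, O j ∈ SigmaP k) ∧ DecidedInPolyTime O L}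

/-! ## Codes of mathematical objects -/

theorem pairStr_inj : ∀ {u u' v v' : Str}, pairStr u v = pairStr u' v' → u = u' ∧ v = v'
  | [], [], v, v', h => by simpa [pairStr] using h
  | [], b :: u', v, v', h => by simp [pairStr] at h
  | b :: u, [], v, v', h => by simp [pairStr] at h
  | b :: u, b' :: u', v, v', h => by
      simp only [pairStr, List.cons.injEq, true_and] at h
      obtain ⟨h1, h2⟩ := pairStr_inj h.2
      exact ⟨by rw [h.1, h1], h2⟩

/-- A way of writing the elements of `α` as bit strings; an element may have several codes. -/
class Coding (α : Type) where
  /-- `Codes u a`: the string `u` is a code of `a` -/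
  Codes : Str → α → Prop
  /-- every element has a code -/
  exists_code : ∀ a, ∃ u, Codes u a
  /-- a string is a code of at most one element -/
  code_unique : ∀ {u a b}, Codes u a → Codes u b → a = b



instance : Coding Str where
  Codes u a := u = a
  exists_code a := ⟨a, rfl⟩
  code_unique h h' := h.symm.trans h'

/-- Natural numbers occur as sizes and indices only; they are written in unary. -/
instance : Coding ℕ where
  Codes u n := u = List.replicate n true
  exists_code n := ⟨_, rfl⟩
  code_unique h h' := by simpa using congrArg List.length (h.symm.trans h')

/-- Binary code of an integer: sign bit, then the binary digits of the absolute value. -/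
def intStr (z : ℤ) : Str := decide (z < 0) :: z.natAbs.bits

theorem natBits_inj {m n : ℕ} (h : m.bits = n.bits) : m = n := by
  rw [← Nat.ofDigits_digits 2 m, ← Nat.ofDigits_digits 2 n, Nat.digits_two_eq_bits,
    Nat.digits_two_eq_bits, h]

theorem intStr_inj {y z : ℤ} (h : intStr y = intStr z) : y = z := by
  simp only [intStr, List.cons.injEq, decide_eq_decide] at h
  have := natBits_inj h.2
  omega

/-- Rational numbers are written as fractions of binary integers, not necessarily reduced. -/
instance : Coding ℚ where
  Codes u x := ∃ (z : ℤ) (d : ℕ), 0 < d ∧ x = (z : ℚ) / (d : ℚ) ∧ u = pairStr (intStr z) d.bits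
  exists_code x := ⟨_, x.num, x.den, x.den_pos, (Rat.num_div_den x).symm, rfl⟩
  code_unique := by
    rintro u a b ⟨z, d, -, ha, hu⟩ ⟨z', d', -, hb, hu'⟩
    obtain ⟨h1, h2⟩ := pairStr_inj (hu.symm.trans hu')
    rw [ha, hb, intStr_inj h1, natBits_inj h2]

instance {α β : Type} [Coding α] [Coding β] : Coding (α × β) where
  Codes u a := ∃ u₁ u₂, Coding.Codes u₁ a.1 ∧ Coding.Codes u₂ a.2 ∧ u = pairStr u₁ u₂
  exists_code a := by
    obtain ⟨u₁, h₁⟩ := Coding.exists_code a.1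
    obtain ⟨u₂, h₂⟩ := Coding.exists_code a.2
    exact ⟨_, u₁, u₂, h₁, h₂, rfl⟩
  code_unique := by
    rintro u a b ⟨u₁, u₂, h₁, h₂, hu⟩ ⟨v₁, v₂, k₁, k₂, hv⟩
    obtain ⟨rfl, rfl⟩ := pairStr_inj (hu.symm.trans hv)
    exact Prod.ext (Coding.code_unique h₁ k₁) (Coding.code_unique h₂ k₂)

/-- Codes of lists: the empty string, or the code of the head paired with a code of the tail. -/
def CodesList {α : Type} [Coding α] : Str → List α → Prop
  | u, [] => u = []
  | u, a :: l => ∃ u₁ u₂, Coding.Codes u₁ a ∧ CodesList u₂ l ∧ u = pairStr u₁ u₂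

theorem pairStr_ne_nil (u v : Str) : pairStr u v ≠ [] := by
  cases u <;> simp [pairStr]

theorem CodesList.exists_code {α : Type} [Coding α] : ∀ l : List α, ∃ u, CodesList u l
  | [] => ⟨[], rfl⟩
  | a :: l => by
      obtain ⟨u₁, h₁⟩ := Coding.exists_code a
      obtain ⟨u₂, h₂⟩ := CodesList.exists_code l
      exact ⟨_, u₁, u₂, h₁, h₂, rfl⟩

theorem CodesList.unique {α : Type} [Coding α] :
    ∀ {u : Str} {l l' : List α}, CodesList u l → CodesList u l' → l = l'
  | _, [], [], _, _ => rfl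
  | _, [], _ :: _, h, ⟨_, _, _, _, hu⟩ => absurd (hu.symm.trans h) (pairStr_ne_nil _ _)
  | _, _ :: _, [], ⟨_, _, _, _, hu⟩, h => absurd (hu.symm.trans h) (pairStr_ne_nil _ _)
  | _, _ :: _, _ :: _, ⟨_, _, h₁, h₂, hu⟩, ⟨_, _, k₁, k₂, hv⟩ => by
      obtain ⟨rfl, rfl⟩ := pairStr_inj (hu.symm.trans hv)
      rw [Coding.code_unique h₁ k₁, CodesList.unique h₂ k₂]

/-- Rational vectors. -/
abbrev Vec := List ℚ

instance : Coding Vec where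
  Codes := CodesList
  exists_code := CodesList.exists_code
  code_unique := CodesList.unique

/-- A finite family is written as the list of its members. -/
instance {α : Type} [Coding α] {n : ℕ} : Coding (Fin n → α) where
  Codes u x := CodesList u (List.ofFn x)
  exists_code _ := CodesList.exists_code _
  code_unique h h' := List.ofFn_injective (CodesList.unique h h')

/-- The language of all codes of elements of a set. -/
def codeLanguage {α : Type} [Coding α] (S : Set α) : Set Str :=
  {u | ∃ a ∈ S, Coding.Codes u a}

/-- `f` is computable in polynomial time: from any code of `a` in register `0` a program computes
a code of `f a` in register `0`, in polynomially many steps. -/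
def PolyTime {α β : Type} [Coding α] [Coding β] (f : α → β) : Prop :=
  ∃ (p : Prog) (q : Polynomial ℕ), ∀ (a : α) (u : Str), Coding.Codes u a → ∃ (τ : Store) (n : ℕ),
    Exec noOracle p (initStore u) τ n ∧ n ≤ q.eval u.length ∧ Coding.Codes (τ 0) (f a)

/-! ## Optimization problems -/

/-- A minimization problem with instances in `ι` and solutions in `S`. -/
structure OptProblem (ι S : Type) where
  /-- the admissible instances -/
  valid : Set ι
  /-- the feasible solutions of an instance -/
  feasible : ι → Set S
  /-- the objective function of an instance -/
  objective : ι → S → ℚ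

namespace OptProblem

variable {ι S κ : Type} [Coding ι] [Coding κ]

/-- The associated decision problem: is there a feasible solution whose objective value is at
least as good as a given bound? -/
def decision (Q : OptProblem ι S) : Set (ι × ℚ) :=
  {p | p.1 ∈ Q.valid ∧ ∃ y ∈ Q.feasible p.1, Q.objective p.1 y ≤ p.2}

/-- An optimization problem is in `Σ_k^P` if its decision problem is. -/
def InSigma (k : ℕ) (Q : OptProblem ι S) : Prop :=
  codeLanguage Q.decision ∈ SigmaP k

/-- The problem `Q`, in epigraph form (minimize `u` over the pairs `(y, u)` with `y` feasible and
objective value of `y` at most `u`), with an additional linear constraint `a ⬝ y + c u ≤ b` and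
with the objective function replaced by a member `h = H e` of the family `H`. The constraint
`(a, c, b)` and the index `e` belong to the instance. -/
def modified (Q : OptProblem ι Vec) (H : κ → Vec → ℚ) :
    OptProblem (ι × (Vec × ℚ × ℚ) × κ) (Vec × ℚ) where
  valid := {p | p.1 ∈ Q.valid}
  feasible := fun ⟨i, ⟨a, c, b⟩, _⟩ =>
    {yu | yu.1 ∈ Q.feasible i ∧ Q.objective i yu.1 ≤ yu.2 ∧ a.length = yu.1.length ∧
      (List.zipWith (· * ·) a yu.1).sum + c * yu.2 ≤ b}
  objective := fun ⟨_, _, e⟩ yu => H e yu.1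

/-- The class `Σ_k^{P*}[H]`: the problem is in `Σ_k^P`, and it remains in `Σ_k^P` with an
additional linear constraint and an objective function from `H`. -/
def InSigmaStar (k : ℕ) (Q : OptProblem ι Vec) (H : κ → Vec → ℚ) : Prop :=
  Q.InSigma k ∧ (Q.modified H).InSigma k

end OptProblem

/-! ## Multilevel problems with near-optimality robustness -/

/-- A class of multilevel problems with `s` upper levels `0, …, s - 1` (level `0` is the top-most)
and one bottom level. The instances of the class are given by bit strings `w`. -/
structure MultilevelProblem (s : ℕ) where
  /-- the domain of the decision of the `i`-th upper level -/
  X : Fin s → Str → Set Vec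
  /-- the objective function of the `i`-th upper level -/
  F : Fin s → Str → (Fin s → Vec) → Vec → ℚ
  /-- the number of constraints of the `i`-th upper level -/
  m : Fin s → Str → ℕ
  /-- `G i w k x y ≤ 0`, `k < m i w`, are the constraints of the `i`-th upper level -/
  G : Fin s → Str → ℕ → (Fin s → Vec) → Vec → ℚ
  /-- the feasible set of the bottom level, parameterized by all upper-level decisions -/
  Y : Str → (Fin s → Vec) → Set Vec
  /-- the objective function of the bottom level -/
  f : Str → (Fin s → Vec) → Vec → ℚ
  /-- the tolerance for near-optimality of the bottom level -/
  δ : Str → ℚ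
  δ_nonneg : ∀ w, 0 ≤ δ w

namespace MultilevelProblem

variable {s : ℕ} (P : MultilevelProblem s)

/-- The bottom-level problem, parameterized by all upper-level decisions. -/
def bottom : OptProblem (Str × (Fin s → Vec)) Vec where
  valid := {p | ∀ i, p.2 i ∈ P.X i p.1}
  feasible := fun p => P.Y p.1 p.2
  objective := fun p => P.f p.1 p.2

/-- The joint decisions `(x, v)` for which `v` is an optimal solution of the bottom level. -/
def bottomOptimal (w : Str) : Set ((Fin s → Vec) × Vec) :=
  {p | p.2 ∈ P.Y w p.1 ∧ ∀ y ∈ P.Y w p.1, P.f w p.1 p.2 ≤ P.f w p.1 y}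

/-- The near-optimal set `𝒵(x; δ)`, for a canonical bottom-level decision `v`. -/
def nearOptimal (w : Str) (p : (Fin s → Vec) × Vec) : Set Vec :=
  {y | y ∈ P.Y w p.1 ∧ P.f w p.1 y ≤ P.f w p.1 p.2 + P.δ w}

/-- The feasible set of the `i`-th upper level, when the constraints of this level have to hold
for all bottom-level decisions in `U p` and the levels below react as in `R`. -/
def levelFeasible (U : (Fin s → Vec) × Vec → Set Vec) (w : Str) (i : Fin s)
    (R : Set ((Fin s → Vec) × Vec)) : Set ((Fin s → Vec) × Vec) :=
  {p | p.1 i ∈ P.X i w ∧ (∀ k < P.m i w, ∀ z ∈ U p, P.G i w k p.1 z ≤ 0) ∧ p ∈ R}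

/-- The optimal solutions of the `i`-th upper level, parameterized by the levels above it. -/
def levelOptimal (U : (Fin s → Vec) × Vec → Set Vec) (w : Str) (i : Fin s)
    (R : Set ((Fin s → Vec) × Vec)) : Set ((Fin s → Vec) × Vec) :=
  {p | p ∈ P.levelFeasible U w i R ∧
    ∀ p' ∈ P.levelFeasible U w i R, (∀ j < i, p'.1 j = p.1 j) →
      P.F i w p.1 p.2 ≤ P.F i w p'.1 p'.2}

/-- The joint decisions in which the levels `i, i + 1, …` react optimally (in the optimistic sense)
to the decisions of the levels above `i`; from `i = s` on only the bottom level is left. -/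
def response (U : (Fin s → Vec) × Vec → Set Vec) (w : Str) (i : ℕ) :
    Set ((Fin s → Vec) × Vec) :=
  if h : i < s then P.levelOptimal U w ⟨i, h⟩ (response U w (i + 1)) else P.bottomOptimal w
termination_by s - i

/-- The problem solved by the top-most level. -/
def topProblem [NeZero s] (U : Str → (Fin s → Vec) × Vec → Set Vec) :
    OptProblem Str ((Fin s → Vec) × Vec) where
  valid := Set.univ
  feasible := fun w => P.levelFeasible (U w) w 0 (P.response (U w) w 1)
  objective := fun w p => P.F 0 w p.1 p.2

/-- The canonical multilevel problem: the constraints of the upper levels hold for the canonical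
bottom-level decision. -/
def canonical [NeZero s] : OptProblem Str ((Fin s → Vec) × Vec) :=
  P.topProblem fun _ p => {p.2}

/-- The generalized near-optimal robust multilevel problem: the constraints of all upper levels
hold for the canonical bottom-level decision and for all near-optimal ones. -/
def gnormp [NeZero s] : OptProblem Str ((Fin s → Vec) × Vec) :=
  P.topProblem fun w p => insert p.2 (P.nearOptimal w p)

/-- The usual conventions on optimization problems in complexity theory: decisions are vectors
of polynomial size, the domains of the upper levels are decidable in polynomial time,
and all data can be evaluated in polynomial time. -/
structure PolyTimeData : Prop where
  dim_X : ∃ n : Fin s → Str → ℕ, ∀ i w, ∀ x ∈ P.X i w, x.length = n i w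
  dim_Y : ∃ n : Str → ℕ, ∀ p ∈ P.bottom.valid, ∀ y ∈ P.Y p.1 p.2, y.length = n p.1
  size_X : ∃ q : Polynomial ℕ, ∀ i w, ∀ x ∈ P.X i w,
    ∃ u : Str, Coding.Codes u x ∧ u.length ≤ q.eval w.length
  size_Y : ∃ q : Polynomial ℕ, ∀ p ∈ P.bottom.valid, ∀ y ∈ P.Y p.1 p.2,
    ∃ u : Str, Coding.Codes u y ∧ u.length ≤ q.eval p.1.length
  mem_X : ∀ i, codeLanguage {p : Str × Vec | p.2 ∈ P.X i p.1} ∈ SigmaP 0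
  polyTime_F : ∀ i, PolyTime fun p : Str × (Fin s → Vec) × Vec => P.F i p.1 p.2.1 p.2.2
  polyTime_m : ∀ i, PolyTime (P.m i)
  polyTime_G : ∀ i, PolyTime fun p : Str × ℕ × (Fin s → Vec) × Vec =>
    P.G i p.1 p.2.1 p.2.2.1 p.2.2.2
  polyTime_f : PolyTime fun p : Str × (Fin s → Vec) × Vec => P.f p.1 p.2.1 p.2.2
  polyTime_δ : PolyTime P.δ

/-- Given bottom-level decisions can be checked for feasibility in polynomial time with oracles
for languages of `Σ_k^P`. -/
def BottomVerifiable (k : ℕ) : Prop :=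
  codeLanguage {p : (Str × (Fin s → Vec)) × Vec | p.1 ∈ P.bottom.valid ∧ p.2 ∈ P.Y p.1.1 p.1.2} ∈
    PWithSigmaOracle k

/-- The functions `- G i w k x ·` belong to the family `H`, with indices that can be computed in
polynomial time. -/
def NegConstraintsIn {κ : Type} [Coding κ] (H : κ → Vec → ℚ) : Prop :=
  ∀ i, ∃ e : Str × ℕ × (Fin s → Vec) → κ, PolyTime e ∧
    ∀ w k x, (w, x) ∈ P.bottom.valid → k < P.m i w →
      ∀ y ∈ P.Y w x, H (e (w, k, x)) y = - P.G i w k x y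

end MultilevelProblem

/-! ## Register programs -/

/-! Let `FP k` denote polynomial time with oracles from `Σ_k^P`. The proof bounds, from the bottom
level upwards, the cost of testing whether in a given joint decision `(x, v)` all levels from `i` on
react optimally.

At the bottom level, `v` fails to be optimal iff some feasible `y` has `f(x, y) < f(x, v)`. This is
a single negated query to the bottom decision problem, so the test is in `FP r`
(`fp_jointResponse_bottom`).

Robustness costs no further level. Some near-optimal `z` violates a constraint `G ≤ 0` iff
minimizing `-G` over the epigraph of the bottom level, under the linear constraint `u ≤ f(x, v) +
δ`, can reach a negative value. The starred class puts this question into `Σ_r^P`, so the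
constraints are tested in `FP r` (`fp_jointConstraints_nearOptimal`). A canonical constraint is
simply evaluated.

At an upper level `i`, suppose that the test for the levels from `i + 1` on is in `FP k` with `r ≤
k`. A better decision of level `i` has polynomial size, so it can be guessed and then verified by
that test; its existence is a `Σ_{k+1}^P` question. Hence optimality at level `i` is in `FP (k + 1)`
(`fp_jointResponse_of_succ`). When only the top-most level remains, the test of the reactions is in
`FP (r + s - 1)`. The top-most level itself needs no optimality test: its decision problem guesses a
joint decision and verifies it, which gives `Σ_{r+s}^P` (`topProblem_inSigma`).

Two details need care. Decision problems compare by `≤`, improvements by `<`; as all denominators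
are at most exponential, lowering a bound slightly translates one into the other
(`le_fracVal_fracPred_iff`). Moreover, codes are not unique and the evaluation programs are
specified on codes only; evaluation is therefore guarded by the feasibility test
(`PolyTime.exists_eval`), and a certificate repeats the given codes of the higher decisions
literally (`exists_codesList_agreeStr`).

All this rests on closure properties of polynomial time on the register machine: composition,
pairing, branching, iteration with bounded intermediate results, and binary arithmetic. They are
proved for programs in a normal form, where only register `0` is nonempty at the start and at the
end. -/

theorem Exec.congr {O : ℕ → Set Str} {p : Prog} {σ τ τ' : Store} {n n' : ℕ}
    (h : Exec O p σ τ n) (hτ : τ = τ') (hn : n = n') : Exec O p σ τ' n' := by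
  subst hτ hn; exact h

/-- `p` leads from `σ` to `τ` in at most `N` steps. -/
def ExecLE (O : ℕ → Set Str) (p : Prog) (σ τ : Store) (N : ℕ) : Prop :=
  ∃ n ≤ N, Exec O p σ τ n

namespace ExecLE

variable {O : ℕ → Set Str} {p q : Prog} {σ τ υ : Store} {M N : ℕ}

theorem seq (h : ExecLE O p σ τ M) (h' : ExecLE O q τ υ N) :
    ExecLE O (.seq p q) σ υ (M + N) := by
  obtain ⟨m, hm, h⟩ := h
  obtain ⟨n, hn, h'⟩ := h'
  exact ⟨m + n, by omega, h.seq h'⟩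

theorem mono (h : ExecLE O p σ τ M) (hN : M ≤ N) : ExecLE O p σ τ N := by
  obtain ⟨m, hm, h⟩ := h
  exact ⟨m, by omega, h⟩

theorem congr {τ' : Store} (h : ExecLE O p σ τ M) (hτ : τ = τ') (hN : M ≤ N) :
    ExecLE O p σ τ' N := hτ ▸ h.mono hN

theorem push (r : ℕ) (b : Bool) : ExecLE O (.push r b) σ (Function.update σ r (b :: σ r)) 1 :=
  ⟨1, le_rfl, .push _ _ _⟩

theorem pop (r : ℕ) : ExecLE O (.pop r) σ (Function.update σ r (σ r).tail) 1 :=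
  ⟨1, le_rfl, .pop _ _⟩

theorem case_nil {r : ℕ} {p₀ p₁ p₂ : Prog} (hr : σ r = []) (h : ExecLE O p₀ σ τ N) :
    ExecLE O (.case r p₀ p₁ p₂) σ τ (N + 1) := by
  obtain ⟨n, hn, h⟩ := h
  exact ⟨n + 1, by omega, .case_nil hr h⟩

theorem case_cons {r : ℕ} {p₀ p₁ p₂ : Prog} {b : Bool} {u : Str} (hr : σ r = b :: u)
    (h : ExecLE O (cond b p₂ p₁) σ τ N) :
    ExecLE O (.case r p₀ p₁ p₂) σ τ (N + 1) := by
  obtain ⟨n, hn, h⟩ := h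
  cases b
  · exact ⟨n + 1, by omega, .case_false (by simp [hr]) h⟩
  · exact ⟨n + 1, by omega, .case_true (by simp [hr]) h⟩

theorem loop_done {r : ℕ} (hr : σ r = []) : ExecLE O (.loop r p) σ σ 1 :=
  ⟨1, le_rfl, .loop_done hr⟩

theorem loop_step {r : ℕ} (hr : σ r ≠ []) (h : ExecLE O p σ τ M)
    (h' : ExecLE O (.loop r p) τ υ N) : ExecLE O (.loop r p) σ υ (M + N + 1) := by
  obtain ⟨m, hm, h⟩ := h
  obtain ⟨n, hn, h'⟩ := h'
  exact ⟨m + n + 1, by omega, .loop_step hr h h'⟩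

end ExecLE

/-- One step adds at most one bit to a register. Outputs of polynomial-time programs thus have
polynomial length, which the time bounds of composed programs depend on. -/
theorem Exec.length_le {O : ℕ → Set Str} {p : Prog} {σ τ : Store} {n : ℕ} (h : Exec O p σ τ n)
    (r : ℕ) : (τ r).length ≤ (σ r).length + n := by
  induction h with
  | push r' b σ => by_cases h : r = r' <;> simp [h]
  | pop r' σ => by_cases h : r = r' <;> simp [h]; omega
  | seq _ _ ih ih' => omega
  | case_nil _ _ ih => omega
  | case_false _ _ ih => omega
  | case_true _ _ ih => omega
  | loop_done _ => omega
  | loop_step _ _ _ ih ih' => omega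
  | @query_yes j r' t σ _ => by_cases h : r = t <;> simp [h]
  | @query_no j r' t σ _ => by_cases h : r = t <;> simp [h]

theorem ExecLE.length_le {O : ℕ → Set Str} {p : Prog} {σ τ : Store} {N : ℕ}
    (h : ExecLE O p σ τ N) (r : ℕ) : (τ r).length ≤ (σ r).length + N := by
  obtain ⟨n, hn, h⟩ := h
  have := h.length_le r
  omega

/-! ### Renumbering of registers and oracles; registers that stay untouched -/

namespace Prog

/-- The program with all registers renumbered by `r ↦ r + 1`. -/
def shift : Prog → Prog
  | push r b => push (r + 1) b
  | pop r => pop (r + 1)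
  | seq p q => seq p.shift q.shift
  | case r p₀ p₁ p₂ => case (r + 1) p₀.shift p₁.shift p₂.shift
  | loop r p => loop (r + 1) p.shift
  | query j r t => query j (r + 1) (t + 1)

/-- The program with its oracles renumbered. -/
def mapOracle (ρ : ℕ → ℕ) : Prog → Prog
  | push r b => push r b
  | pop r => pop r
  | seq p q => seq (p.mapOracle ρ) (q.mapOracle ρ)
  | case r p₀ p₁ p₂ => case r (p₀.mapOracle ρ) (p₁.mapOracle ρ) (p₂.mapOracle ρ)
  | loop r p => loop r (p.mapOracle ρ)
  | query j r t => query (ρ j) r t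

/-- All registers that the program mentions are smaller than this number. -/
def bound : Prog → ℕ
  | push r _ => r + 1
  | pop r => r + 1
  | seq p q => max p.bound q.bound
  | case _ p₀ p₁ p₂ => max p₀.bound (max p₁.bound p₂.bound)
  | loop _ p => p.bound
  | query _ _ t => t + 1

end Prog

/-- Put a new register in front of all others. -/
def Store.cons (a : Str) (σ : Store) : Store
  | 0 => a
  | r + 1 => σ r

theorem Store.update_cons (a : Str) (σ : Store) (r : ℕ) (u : Str) :
    Function.update (Store.cons a σ) (r + 1) u = Store.cons a (Function.update σ r u) := by
  funext i
  cases i <;> simp [Store.cons, Function.update_apply]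

/-- Keeps register `0` free to save a value while the program runs on the registers behind it. -/
theorem Exec.shift {O : ℕ → Set Str} {p : Prog} {σ τ : Store} {n : ℕ} (h : Exec O p σ τ n)
    (a : Str) : Exec O p.shift (Store.cons a σ) (Store.cons a τ) n := by
  induction h with
  | push r b σ => exact (Exec.push (r + 1) b _).congr (Store.update_cons ..) rfl
  | pop r σ => exact (Exec.pop (r + 1) _).congr (Store.update_cons ..) rfl
  | seq _ _ ih ih' => exact ih.seq ih'
  | case_nil h _ ih => exact .case_nil h ih
  | case_false h _ ih => exact .case_false h ih
  | case_true h _ ih => exact .case_true h ih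
  | loop_done h => exact .loop_done h
  | loop_step h _ _ ih ih' => exact .loop_step h ih ih'
  | query_yes h =>
      exact (Exec.query_yes (σ := Store.cons a _) (r := _ + 1) h).congr (Store.update_cons ..) rfl
  | query_no h =>
      exact (Exec.query_no (σ := Store.cons a _) (r := _ + 1) h).congr (Store.update_cons ..) rfl

theorem Exec.mapOracle {O O' : ℕ → Set Str} {ρ : ℕ → ℕ} (hρ : ∀ j, O' (ρ j) = O j) {p : Prog}
    {σ τ : Store} {n : ℕ} (h : Exec O p σ τ n) : Exec O' (p.mapOracle ρ) σ τ n := by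
  induction h with
  | push r b σ => exact .push ..
  | pop r σ => exact .pop ..
  | seq _ _ ih ih' => exact ih.seq ih'
  | case_nil h _ ih => exact .case_nil h ih
  | case_false h _ ih => exact .case_false h ih
  | case_true h _ ih => exact .case_true h ih
  | loop_done h => exact .loop_done h
  | loop_step h _ _ ih ih' => exact .loop_step h ih ih'
  | query_yes h => exact .query_yes (by rwa [hρ])
  | query_no h => exact .query_no (by rwa [hρ])

/-- Only writing changes a register. Accordingly `Prog.bound` takes account of the registers that
are pushed on, popped or receive an answer, and not of those that are merely tested or queried. -/
theorem Exec.eq_of_bound_le {O : ℕ → Set Str} {p : Prog} {σ τ : Store} {n : ℕ}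
    (h : Exec O p σ τ n) {r : ℕ} (hr : p.bound ≤ r) : τ r = σ r := by
  induction h with
  | push r' b σ => exact Function.update_of_ne (by simp [Prog.bound] at hr; omega) _ _
  | pop r' σ => exact Function.update_of_ne (by simp [Prog.bound] at hr; omega) _ _
  | seq _ _ ih ih' =>
      simp only [Prog.bound, max_le_iff] at hr
      rw [ih' hr.2, ih hr.1]
  | case_nil _ _ ih => simp only [Prog.bound, max_le_iff] at hr; exact ih hr.1
  | case_false _ _ ih => simp only [Prog.bound, max_le_iff] at hr; exact ih hr.2.1
  | case_true _ _ ih => simp only [Prog.bound, max_le_iff] at hr; exact ih hr.2.2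
  | loop_done _ => rfl
  | loop_step _ _ _ ih ih' => rw [ih' hr, ih hr]
  | query_yes _ => exact Function.update_of_ne (by simp [Prog.bound] at hr; omega) _ _
  | query_no _ => exact Function.update_of_ne (by simp [Prog.bound] at hr; omega) _ _

/-! ### Clearing and moving registers -/

namespace Prog

/-- Do nothing. -/
def skip : Prog := seq (push 0 true) (pop 0)

/-- Empty a register. -/
def clear (r : ℕ) : Prog := loop r (pop r)

/-- Empty the registers `1, …, B`. -/
def clearUpTo : ℕ → Prog
  | 0 => skip
  | B + 1 => seq (clearUpTo B) (clear (B + 1))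

/-- Move the content of register `r` onto register `t`; this reverses it. -/
def mvrev (r t : ℕ) : Prog :=
  loop r (case r skip (seq (pop r) (push t false)) (seq (pop r) (push t true)))

/-- Move the content of register `r` onto registers `t` and `t'`. -/
def mvrev₂ (r t t' : ℕ) : Prog :=
  loop r (case r skip (seq (pop r) (seq (push t false) (push t' false)))
    (seq (pop r) (seq (push t true) (push t' true))))

end Prog

section

variable {O : ℕ → Set Str} {σ : Store}

theorem exec_skip : ExecLE O .skip σ σ 2 :=
  ((ExecLE.push 0 true).seq (.pop 0)).congr (by simp) (by simp)

theorem exec_clear (r : ℕ) :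
    ExecLE O (.clear r) σ (Function.update σ r []) (2 * (σ r).length + 1) := by
  induction h : σ r generalizing σ with
  | nil => exact (ExecLE.loop_done h).congr (by rw [← h]; simp) (by simp)
  | cons b u ih =>
      have := ih (σ := Function.update σ r u) (by simp)
      refine (ExecLE.loop_step (by simp [h]) ((ExecLE.pop r).congr ?_ le_rfl) this).congr
        (by simp) (by simp; omega)
      simp [h]

theorem exec_mvrev {r t : ℕ} (hrt : r ≠ t) :
    ExecLE O (.mvrev r t) σ
      (Function.update (Function.update σ t ((σ r).reverse ++ σ t)) r [])
      (4 * (σ r).length + 1) := by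
  induction h : σ r generalizing σ with
  | nil =>
      have h' := Function.update_eq_self r σ
      rw [h] at h'
      exact (ExecLE.loop_done h).congr (by simp [h']) (by simp)
  | cons b u ih =>
      have := ih (σ := Function.update (Function.update σ r u) t (b :: σ t)) (by simp [hrt])
      refine (ExecLE.loop_step (M := 3) (by simp [h]) (.case_cons h ?_) this).congr ?_
        (by simp; omega)
      · cases b <;>
        exact ((ExecLE.pop r).seq (.push t _)).congr (by simp [h, hrt.symm]) le_rfl
      · funext i
        by_cases h1 : i = r <;> by_cases h2 : i = t <;> simp_all

theorem exec_mvrev₂ {r t t' : ℕ} (hrt : r ≠ t) (hrt' : r ≠ t') (htt' : t ≠ t') :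
    ExecLE O (.mvrev₂ r t t') σ
      (Function.update (Function.update (Function.update σ t ((σ r).reverse ++ σ t))
        t' ((σ r).reverse ++ σ t')) r [])
      (5 * (σ r).length + 1) := by
  induction h : σ r generalizing σ with
  | nil =>
      have h' := Function.update_eq_self r σ
      rw [h] at h'
      exact (ExecLE.loop_done h).congr (by simp [h']) (by simp)
  | cons b u ih =>
      have := ih (σ := Function.update (Function.update (Function.update σ r u) t (b :: σ t))
        t' (b :: σ t')) (by simp [hrt, hrt'])
      refine (ExecLE.loop_step (M := 4) (by simp [h]) (.case_cons h ?_) this).congr ?_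
        (by simp; omega)
      · cases b <;>
        exact ((ExecLE.pop r).seq ((ExecLE.push t _).seq (.push t' _))).congr
          (by simp [h, hrt.symm, hrt'.symm, htt'.symm]) le_rfl
      · funext i
        by_cases h1 : i = r <;> by_cases h2 : i = t <;> by_cases h3 : i = t' <;>
          simp_all [Function.update_apply]

theorem exec_clearUpTo (N : ℕ) (hN : ∀ r, 1 ≤ r → (σ r).length ≤ N) (B : ℕ) :
    ExecLE O (.clearUpTo B) σ (fun r => if 1 ≤ r ∧ r ≤ B then [] else σ r)
      (2 + B * (2 * N + 1)) := by
  induction B with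
  | zero => exact exec_skip.congr (by funext r; rw [if_neg]; omega) (by simp)
  | succ B ih =>
      refine (ih.seq (exec_clear (B + 1))).congr ?_ ?_
      · funext r
        by_cases h : r = B + 1
        · subst h; simp
        · rw [Function.update_of_ne h]
          congr 1
          simp only [eq_iff_iff]
          omega
      · have := hN (B + 1) (by omega)
        simp
        rw [add_mul]
        omega

/-- Every program can be extended such that only the output register is left nonempty. -/
theorem exec_clean {p : Prog} {u : Str} {τ : Store} {N : ℕ}
    (h : ExecLE O p (initStore u) τ N) :
    ExecLE O (.seq p (.clearUpTo p.bound)) (initStore u) (initStore (τ 0))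
      (N + (2 + p.bound * (2 * N + 1))) := by
  have hl := h.length_le
  refine (h.seq (exec_clearUpTo N (fun r hr => ?_) _)).congr ?_ le_rfl
  · have := hl r
    rwa [initStore, if_neg (by omega), List.length_nil, zero_add] at this
  · obtain ⟨n, -, h⟩ := h
    funext r
    by_cases h0 : r = 0
    · simp [initStore, h0]
    · by_cases hr : r ≤ p.bound
      · simp [initStore, h0, hr, Nat.one_le_iff_ne_zero]
      · simp only [hr, and_false, if_false]
        rw [h.eq_of_bound_le (by omega)]
        simp [initStore, h0]

end

/-! ### Programs on the first four registers -/

/-- The store with the given contents of the first four registers; the others are empty. -/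
def regs (a b c d : Str) : Store
  | 0 => a
  | 1 => b
  | 2 => c
  | 3 => d
  | _ => []

section

variable (a b c d x : Str)

@[simp] theorem regs_zero : regs a b c d 0 = a := rfl
@[simp] theorem regs_one : regs a b c d 1 = b := rfl
@[simp] theorem regs_two : regs a b c d 2 = c := rfl
@[simp] theorem regs_three : regs a b c d 3 = d := rfl

@[simp] theorem update_regs_zero : Function.update (regs a b c d) 0 x = regs x b c d := by
  funext r; rcases r with _ | _ | _ | _ | r <;> simp [regs]
@[simp] theorem update_regs_one : Function.update (regs a b c d) 1 x = regs a x c d := by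
  funext r; rcases r with _ | _ | _ | _ | r <;> simp [regs]
@[simp] theorem update_regs_two : Function.update (regs a b c d) 2 x = regs a b x d := by
  funext r; rcases r with _ | _ | _ | _ | r <;> simp [regs]
@[simp] theorem update_regs_three : Function.update (regs a b c d) 3 x = regs a b c x := by
  funext r; rcases r with _ | _ | _ | _ | r <;> simp [regs]

theorem initStore_eq_regs : initStore a = regs a [] [] [] := by
  funext r; rcases r with _ | _ | _ | _ | r <;> simp [initStore, regs]

theorem cons_initStore : Store.cons x (initStore a) = regs x a [] [] := by
  funext r; rcases r with _ | _ | _ | _ | r <;> simp [initStore, regs, Store.cons]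

end

section

variable {O : ℕ → Set Str}

theorem ExecLE.shift {p : Prog} {a b : Str} {N : ℕ}
    (h : ExecLE O p (initStore a) (initStore b) N) (x : Str) :
    ExecLE O p.shift (regs x a [] []) (regs x b [] []) N := by
  obtain ⟨n, hn, h⟩ := h
  exact ⟨n, hn, by simpa only [cons_initStore] using h.shift x⟩

/-- Copy register `0` to register `1`. -/
def Prog.copy : Prog := .seq (.mvrev 0 2) (.mvrev₂ 2 0 1)

theorem exec_copy (a : Str) :
    ExecLE O .copy (regs a [] [] []) (regs a a [] []) (9 * a.length + 2) :=
  ((exec_mvrev (by decide)).seq (exec_mvrev₂ (by decide) (by decide) (by decide))).congr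
    (by simp) (by simp; omega)

/-- Exchange registers `0` and `1`. -/
def Prog.swap : Prog := .seq (.seq (.mvrev 0 2) (.mvrev 1 3)) (.seq (.mvrev 2 1) (.mvrev 3 0))

theorem exec_swap (a b : Str) :
    ExecLE O .swap (regs a b [] []) (regs b a [] []) (8 * (a.length + b.length) + 4) :=
  (((exec_mvrev (by decide)).seq (exec_mvrev (by decide))).seq
    ((exec_mvrev (by decide)).seq (exec_mvrev (by decide)))).congr
    (by simp) (by simp; omega)

/-- From `v` in register `0` and `u` in register `1` compute their pairing in register `0`. -/
def Prog.pairUp : Prog :=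
  .seq (.mvrev 1 2) (.seq (.push 0 false)
    (.loop 2 (.case 2 .skip (.seq (.pop 2) (.seq (.push 0 false) (.push 0 true)))
      (.seq (.pop 2) (.seq (.push 0 true) (.push 0 true))))))

/-- Register `2` holds the first component reversed, so its last bit is consumed first and the pair
grows from the inside outwards. -/
theorem exec_pairUp_loop (v l : Str) :
    ExecLE O (.loop 2 (.case 2 .skip (.seq (.pop 2) (.seq (.push 0 false) (.push 0 true)))
      (.seq (.pop 2) (.seq (.push 0 true) (.push 0 true))))) (regs v [] l [])
      (regs (l.foldl (fun v b => true :: b :: v) v) [] [] []) (5 * l.length + 1) := by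
  induction l generalizing v with
  | nil => exact (ExecLE.loop_done rfl).congr rfl (by simp)
  | cons b l ih =>
      refine (ExecLE.loop_step (M := 4) (by simp) (.case_cons (b := b) (u := l) rfl ?_)
        (ih (true :: b :: v))).congr rfl (by simp; omega)
      cases b <;>
      exact ((ExecLE.pop 2).seq ((ExecLE.push 0 _).seq (.push 0 _))).congr (by simp) le_rfl

theorem pairStr_eq_foldr (u v : Str) :
    pairStr u v = u.foldr (fun b v => true :: b :: v) (false :: v) := by
  induction u with
  | nil => rfl
  | cons b u ih => simp [pairStr, ih]

theorem length_pairStr (u v : Str) : (pairStr u v).length = 2 * u.length + v.length + 1 := by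
  induction u with
  | nil => simp [pairStr]
  | cons b u ih => simp [pairStr, ih]; omega

theorem exec_pairUp (u v : Str) :
    ExecLE O .pairUp (regs v u [] []) (regs (pairStr u v) [] [] []) (9 * u.length + 3) := by
  refine ((exec_mvrev (by decide)).seq
    (((ExecLE.push 0 false).congr (τ' := regs (false :: v) [] u.reverse []) ?_ le_rfl).seq
      (exec_pairUp_loop _ _))).congr ?_ ?_
  · simp
  · rw [List.foldl_reverse, pairStr_eq_foldr]
  · simp; omega
  
/-- The inverse of the pairing (with arbitrary values on strings that are not pairs). -/
def unpairStr : Str → Str × Str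
  | [] => ([], [])
  | false :: v => ([], v)
  | [true] => ([], [])
  | true :: b :: s => (b :: (unpairStr s).1, (unpairStr s).2)

@[simp] theorem unpairStr_pairStr (u v : Str) : unpairStr (pairStr u v) = (u, v) := by
  induction u with
  | nil => rfl
  | cons b u ih => simp [pairStr, unpairStr, ih]

theorem length_unpairStr (s : Str) :
    (unpairStr s).1.length + (unpairStr s).2.length ≤ s.length := by
  induction s using unpairStr.induct with
  | case1 => simp [unpairStr]
  | case2 => simp [unpairStr]
  | case3 => simp [unpairStr]
  | case4 b s ih => simp [unpairStr]; omega

/-- The loop of the program that splits a pair. -/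
def Prog.splitLoop : Prog :=
  .loop 2 (.case 0 (.pop 2) (.seq (.pop 0) (.pop 2))
    (.seq (.pop 0) (.case 0 (.pop 2) (.seq (.pop 0) (.push 1 false))
      (.seq (.pop 0) (.push 1 true)))))

/-- From a pair in register `0` compute the second component in register `0` and the reverse of
the first one in register `1`. -/
def Prog.split : Prog := .seq (.push 2 true) .splitLoop

/-- Register `2` is a flag that keeps the loop alive. It is popped at the separator `false` and also
when the input breaks off, so the program halts on strings that are not pairs as well. -/
theorem exec_splitLoop (s x : Str) :
    ExecLE O .splitLoop (regs s x [true] [])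
      (regs (unpairStr s).2 ((unpairStr s).1.reverse ++ x) [] []) (6 * s.length + 6) := by
  have hdone : ∀ s x, ExecLE O .splitLoop (regs s x [] []) (regs s x [] []) 1 := fun s x =>
    .loop_done rfl
  induction s using unpairStr.induct generalizing x with
  | case1 =>
      refine (ExecLE.loop_step (by simp) (.case_nil rfl ((ExecLE.pop 2).congr ?_ le_rfl))
        (hdone [] x)).congr ?_ ?_ <;>
      simp [unpairStr]
  | case2 v =>
      refine (ExecLE.loop_step (by simp) (.case_cons (b := false) rfl
        (((ExecLE.pop 0).seq (.pop 2)).congr ?_ le_rfl)) (hdone v x)).congr ?_ ?_ <;>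
      simp [unpairStr]
  | case3 =>
      refine (ExecLE.loop_step (by simp) (.case_cons (b := true) rfl
        (((ExecLE.pop 0).seq (.case_nil ?_ (.pop 2))).congr ?_ le_rfl)) (hdone [] x)).congr ?_ ?_ <;>
      simp [unpairStr]
  | case4 b s ih =>
      refine (ExecLE.loop_step (M := 5) (by simp) (.case_cons (b := true) rfl
        ((ExecLE.pop 0).seq (.case_cons (b := b) (u := s) (N := 2) ?_ ?_)))
        (ih (b :: x))).congr ?_ ?_
      · simp
      · cases b <;> exact ((ExecLE.pop 0).seq (.push 1 _)).congr (by simp) le_rfl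
      · simp [unpairStr]
      · simp; omega

theorem exec_split (s : Str) :
    ExecLE O .split (regs s [] [] [])
      (regs (unpairStr s).2 (unpairStr s).1.reverse [] []) (6 * s.length + 7) := by
  refine (((ExecLE.push 2 true).congr ?_ le_rfl).seq (exec_splitLoop s [])).congr ?_ ?_
  · simp
  · simp
  · omega

end

/-! ## Functions computable in polynomial time -/

/-- Types whose elements are written as bit strings in one fixed way. -/
class Enc (α : Type) where
  /-- the string that represents an element -/
  enc : α → Str

open Enc (enc)

instance : Enc Str := ⟨id⟩
instance : Enc Bool := ⟨fun b => [b]⟩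
instance {α β : Type} [Enc α] [Enc β] : Enc (α × β) := ⟨fun a => pairStr (enc a.1) (enc a.2)⟩
instance {α : Type} [Enc α] (p : α → Prop) : Enc {a // p a} := ⟨fun a => enc a.1⟩
/-- Natural numbers in binary. -/
instance : Enc ℕ := ⟨Nat.bits⟩
instance : Enc ℤ := ⟨intStr⟩

@[simp] theorem enc_str (u : Str) : enc u = u := rfl
@[simp] theorem enc_bool (b : Bool) : enc b = [b] := rfl
@[simp] theorem enc_prod {α β : Type} [Enc α] [Enc β] (a : α × β) :
    enc a = pairStr (enc a.1) (enc a.2) := rfl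
@[simp] theorem enc_subtype {α : Type} [Enc α] (p : α → Prop) (a : {a // p a}) :
    enc a = enc a.1 := rfl
@[simp] theorem enc_nat (n : ℕ) : enc n = n.bits := rfl
@[simp] theorem enc_int (z : ℤ) : enc z = intStr z := rfl

theorem polynomial_eval_mono (q : Polynomial ℕ) {m n : ℕ} (h : m ≤ n) : q.eval m ≤ q.eval n := by
  rw [Polynomial.eval_eq_sum_range, Polynomial.eval_eq_sum_range]
  gcongr

open Classical in
/-- The characteristic function of a language. -/
noncomputable def charFun (L : Set Str) (u : Str) : Bool := decide (u ∈ L)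

@[simp] theorem charFun_eq_true {L : Set Str} {u : Str} : charFun L u = true ↔ u ∈ L := by
  simp [charFun]

@[simp] theorem charFun_eq_false {L : Set Str} {u : Str} : charFun L u = false ↔ u ∉ L := by
  simp [charFun]

/-- `f` is computable in polynomial time with the oracles `O`. -/
def PolyFun (O : ℕ → Set Str) {α β : Type} [Enc α] [Enc β] (f : α → β) : Prop :=
  ∃ (p : Prog) (q : Polynomial ℕ), ∀ a,
    ExecLE O p (initStore (enc a)) (initStore (enc (f a))) (q.eval (enc a).length)

/-! ### Closure properties for a fixed family of oracles -/

namespace PolyFun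

variable {O : ℕ → Set Str} {α β γ σ : Type} [Enc α] [Enc β] [Enc γ] [Enc σ]

theorem length_le {f : α → β} (hf : PolyFun O f) :
    ∃ q : Polynomial ℕ, ∀ a, (enc (f a)).length ≤ q.eval (enc a).length := by
  obtain ⟨p, q, h⟩ := hf
  exact ⟨.X + q, fun a => by simpa [initStore] using (h a).length_le 0⟩

theorem of_oracle_subset {O' : ℕ → Set Str} {f : α → β} (hf : PolyFun O f)
    (h : ∀ j, ∃ j', O' j' = O j) : PolyFun O' f := by
  obtain ⟨p, q, hp⟩ := hf
  choose ρ hρ using h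
  refine ⟨p.mapOracle ρ, q, fun a => ?_⟩
  obtain ⟨n, hn, hp⟩ := hp a
  exact ⟨n, hn, hp.mapOracle hρ⟩

/-- A function computed on the representing strings. -/
theorem lift {f : α → β} {F : Str → Str} (hF : PolyFun O F) (h : ∀ a, F (enc a) = enc (f a)) :
    PolyFun O f := by
  obtain ⟨p, q, hp⟩ := hF
  exact ⟨p, q, fun a => by simpa [h] using hp (enc a)⟩

theorem of_enc_eq {f : α → β} (h : ∀ a, enc (f a) = enc a) : PolyFun O f :=
  ⟨.skip, 2, fun a => by simpa [h] using exec_skip⟩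

theorem id : PolyFun O fun a : α => a := of_enc_eq fun _ => rfl

theorem comp {g : β → γ} {f : α → β} (hg : PolyFun O g) (hf : PolyFun O f) :
    PolyFun O fun a => g (f a) := by
  obtain ⟨r, hr⟩ := hf.length_le
  obtain ⟨p, q, hp⟩ := hg
  obtain ⟨p', q', hp'⟩ := hf
  refine ⟨.seq p' p, q' + q.comp r, fun a => ((hp' a).seq (hp _)).mono ?_⟩
  simpa using polynomial_eval_mono q (hr a)

theorem cons (b : Bool) : PolyFun O fun u : Str => b :: u :=
  ⟨.push 0 b, 1, fun u => (ExecLE.push 0 b).congr (by simp [initStore_eq_regs]) (by simp)⟩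

theorem tail : PolyFun O fun u : Str => u.tail :=
  ⟨.pop 0, 1, fun u => (ExecLE.pop 0).congr (by simp [initStore_eq_regs]) (by simp)⟩

theorem const_nil : PolyFun O fun _ : α => ([] : Str) :=
  ⟨.clear 0, 2 * .X + 1, fun a =>
    (exec_clear 0).congr (by simp [initStore_eq_regs]) (by simp [initStore_eq_regs])⟩

theorem const (b : β) : PolyFun O fun _ : α => b := by
  have : ∀ v : Str, PolyFun O fun _ : α => v := fun v => by
    induction v with
    | nil => exact const_nil
    | cons x v ih => exact (cons x).comp ih
  obtain ⟨p, q, h⟩ := this (enc b)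
  exact ⟨p, q, h⟩

theorem headD : PolyFun O fun u : Str => u.headD false := by
  refine ⟨.case 0 (.push 0 false) (.seq (.clear 0) (.push 0 false))
    (.seq (.clear 0) (.push 0 true)), 2 * .X + 4, fun u => ?_⟩
  rcases u with _ | ⟨b, u⟩
  · exact (ExecLE.case_nil rfl (.push 0 false)).congr (by simp [initStore_eq_regs]) (by simp)
  · refine (ExecLE.case_cons (b := b) (u := u) (N := 2 * (u.length + 1) + 2) rfl ?_).mono (by simp)
    cases b <;>
    exact ((exec_clear 0).seq (.push 0 _)).congr (by simp [initStore_eq_regs])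
      (by simp [initStore_eq_regs])

theorem isEmpty : PolyFun O fun u : Str => u.isEmpty := by
  refine ⟨.case 0 (.push 0 true) (.seq (.clear 0) (.push 0 false))
    (.seq (.clear 0) (.push 0 false)), 2 * .X + 4, fun u => ?_⟩
  rcases u with _ | ⟨b, u⟩
  · exact (ExecLE.case_nil rfl (.push 0 true)).congr (by simp [initStore_eq_regs]) (by simp)
  · refine (ExecLE.case_cons (b := b) (u := u) (N := 2 * (u.length + 1) + 2) rfl ?_).mono (by simp)
    cases b <;>
    exact ((exec_clear 0).seq (.push 0 _)).congr (by simp [initStore_eq_regs])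
      (by simp [initStore_eq_regs])

theorem query (j : ℕ) : PolyFun O (charFun (O j)) := by
  refine ⟨.seq (.query j 0 1) (.seq (.clear 0) (.mvrev 1 0)), 2 * .X + 7, fun u => ?_⟩
  have h : ExecLE O (.query j 0 1) (regs u [] [] []) (regs u [charFun (O j) u] [] []) 1 := by
    by_cases hu : u ∈ O j
    · exact ⟨1, le_rfl, (Exec.query_yes (by simpa)).congr (by simp [charFun, hu]) rfl⟩
    · exact ⟨1, le_rfl, (Exec.query_no (by simpa)).congr (by simp [charFun, hu]) rfl⟩
  rw [initStore_eq_regs, initStore_eq_regs]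
  exact (h.seq ((exec_clear 0).seq (exec_mvrev (by decide)))).congr (by simp) (by simp; omega)

theorem unpairFst : PolyFun O fun u : Str => (unpairStr u).1 := by
  refine ⟨.seq .split (.seq (.clear 0) (.mvrev 1 0)), 12 * .X + 9, fun u => ?_⟩
  rw [initStore_eq_regs, initStore_eq_regs]
  refine ((exec_split _).seq ((exec_clear 0).seq (exec_mvrev (by decide)))).congr (by simp) ?_
  have := length_unpairStr u
  simp
  omega

theorem unpairSnd : PolyFun O fun u : Str => (unpairStr u).2 := by
  refine ⟨.seq .split (.clear 1), 8 * .X + 8, fun u => ?_⟩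
  rw [initStore_eq_regs, initStore_eq_regs]
  refine ((exec_split _).seq (exec_clear 1)).congr (by simp) ?_
  have := length_unpairStr u
  simp
  omega

theorem fst : PolyFun O fun a : α × β => a.1 := unpairFst.lift fun a => by simp

theorem snd : PolyFun O fun a : α × β => a.2 := unpairSnd.lift fun a => by simp

theorem pair {f : α → β} {g : α → γ} (hf : PolyFun O f) (hg : PolyFun O g) :
    PolyFun O fun a => (f a, g a) := by
  obtain ⟨r, hr⟩ := hf.length_le
  obtain ⟨r', hr'⟩ := hg.length_le
  obtain ⟨p, q, hp⟩ := hf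
  obtain ⟨p', q', hp'⟩ := hg
  -- The second component is computed first, on the copy in register `1`. After the exchange, `p`
  -- turns the saved argument into the first component, which is then in register `1` as
  -- `Prog.pairUp` expects.
  refine ⟨.seq .copy (.seq p'.shift (.seq .swap (.seq p.shift .pairUp))),
    17 * .X + 8 * r' + 9 * r + q + q' + 9, fun a => ?_⟩
  rw [initStore_eq_regs, initStore_eq_regs]
  refine ((exec_copy _).seq (((hp' a).shift _).seq ((exec_swap _ _).seq (((hp a).shift _).seq
    (exec_pairUp _ _))))).congr rfl ?_
  have := hr a
  have := hr' a
  simp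
  omega

/-- Each branch has to be computable only on the arguments that reach it. This permits branches
whose programs come without any guarantee, even of halting, elsewhere. -/
theorem ite_subtype {c : α → Bool} {f : {a // c a = true} → β} {g : {a // c a = false} → β}
    {h : α → β} (hc : PolyFun O c) (hf : PolyFun O f) (hg : PolyFun O g)
    (hhf : ∀ a : {a // c a = true}, h a = f a) (hhg : ∀ a : {a // c a = false}, h a = g a) :
    PolyFun O h := by
  obtain ⟨p₀, q₀, hp₀⟩ := hc
  obtain ⟨p, q, hp⟩ := hf
  obtain ⟨p', q', hp'⟩ := hg
  refine ⟨.seq .copy (.seq p₀.shift (.case 1 .skip (.seq (.pop 1) p') (.seq (.pop 1) p))),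
    9 * .X + q₀ + q + q' + 4, fun a => ?_⟩
  rw [initStore_eq_regs]
  refine ((exec_copy _).seq (((hp₀ a).shift _).seq (ExecLE.case_cons (b := c a) (u := [])
    (N := q.eval (enc a).length + q'.eval (enc a).length + 1) ?_ (τ := initStore (enc (h a)))
      ?_))).mono ?_
  · rfl
  · have hpop : ExecLE O (.pop 1) (regs (enc a) (enc (c a)) [] []) (initStore (enc a)) 1 :=
      (ExecLE.pop 1).congr (by simp [initStore_eq_regs]) le_rfl
    cases hca : c a
    · rw [hca] at hpop
      exact (hpop.seq (hp' ⟨a, hca⟩)).congr (by rw [hhg ⟨a, hca⟩]) (by simp; omega)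
    · rw [hca] at hpop
      exact (hpop.seq (hp ⟨a, hca⟩)).congr (by rw [hhf ⟨a, hca⟩]) (by simp; omega)
  · simp
    omega

theorem ite {c : α → Bool} {f g : α → β} (hc : PolyFun O c) (hf : PolyFun O f)
    (hg : PolyFun O g) : PolyFun O fun a => bif c a then f a else g a := by
  have hval : ∀ P : α → Prop, PolyFun O fun a : {a // P a} => a.1 := fun P =>
    of_enc_eq fun _ => rfl
  exact ite_subtype hc (hf.comp (hval _)) (hg.comp (hval _)) (fun a => by simp [a.2])
    (fun a => by simp [a.2])

/-- A loop pops a counter in register `0` and runs the shifted step program on the state in register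
`1`. The bound on all intermediate states is indispensable: iterating a polynomial-time step can
otherwise produce exponentially long strings. -/
theorem iterate {cnt : α → Str} {init : α → σ} {step : σ → σ} (hcnt : PolyFun O cnt)
    (hinit : PolyFun O init) (hstep : PolyFun O step) (b : Polynomial ℕ)
    (hb : ∀ a, ∀ i ≤ (cnt a).length, (enc (step^[i] (init a))).length ≤ b.eval (enc a).length) :
    PolyFun O fun a => step^[(cnt a).length] (init a) := by
  have hpair := hcnt.pair hinit
  obtain ⟨r, hr⟩ := hpair.length_le
  obtain ⟨p₀, q₀, hp₀⟩ := hpair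
  obtain ⟨p, q, hp⟩ := hstep
  have loop : ∀ (M : ℕ) (l : Str) (s : σ),
      (∀ i ≤ l.length, (enc (step^[i] s)).length ≤ M) →
      ExecLE O (.loop 0 (.seq (.pop 0) p.shift)) (regs l (enc s) [] [])
        (regs [] (enc (step^[l.length] s)) [] []) (l.length * (q.eval M + 2) + 1) := by
    intro M l
    induction l with
    | nil => exact fun s _ => (ExecLE.loop_done rfl).congr rfl (by simp)
    | cons x l ih =>
        intro s hs
        refine (ExecLE.loop_step (M := q.eval M + 1) (by simp)
          (((ExecLE.pop 0).congr ?_ le_rfl).seq ((hp s).shift l) |>.mono ?_)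
          (ih (step s) fun i hi => hs (i + 1) (by simpa using hi))).congr rfl ?_
        · simp
        · have := polynomial_eval_mono q (hs 0 (by simp))
          simp at this
          omega
        · simp [add_mul]
          omega
  refine ⟨.seq p₀ (.seq .split (.seq .swap (.seq (.loop 0 (.seq (.pop 0) p.shift)) .swap))),
    q₀ + 14 * r + r * (q.comp b + 2) + 8 * b + 16, fun a => ?_⟩
  -- Splitting leaves the counter reversed, which does no harm because only its length matters.
  have h1 := loop (b.eval (enc a).length) (cnt a).reverse (init a) (by simpa using hb a)
  have h2 := hr a
  have h3 := hb a _ le_rfl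
  have h4 := exec_split (O := O) (pairStr (cnt a) (enc (init a)))
  rw [unpairStr_pairStr] at h4
  rw [initStore_eq_regs (enc (step^[_] _))]
  refine ((hp₀ a).congr (initStore_eq_regs _) le_rfl |>.seq (h4.seq
    ((exec_swap _ _).seq (h1.seq (exec_swap _ _))))).congr ?_ ?_
  · simp
  · simp [length_pairStr] at h2 h3 ⊢
    have h5 : (cnt a).length * (q.eval (b.eval (enc a).length) + 2) ≤
        r.eval (enc a).length * (q.eval (b.eval (enc a).length) + 2) := by gcongr; omega
    omega

end PolyFun

/-! ## Polynomial time with oracles in the polynomial hierarchy -/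

section

variable {O : ℕ → Set Str} {L : Set Str}

/-- A deciding program may leave anything behind and answers by a top bit; clearing the other
registers and extracting this bit produces the normal form. -/
theorem decidedInPolyTime_iff : DecidedInPolyTime O L ↔ PolyFun O (charFun L) := by
  constructor
  · rintro ⟨p, q, h⟩
    choose τ n h using h
    have h1 : PolyFun O fun u => τ u 0 := by
      refine ⟨.seq p (.clearUpTo p.bound), q + (2 + (p.bound : Polynomial ℕ) * (2 * q + 1)),
        fun u => ?_⟩
      exact (exec_clean ⟨n u, (h u).2.1, (h u).1⟩).mono (by simp)
    convert PolyFun.headD.comp h1 using 1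
    funext u
    have := (h u).2.2
    rcases hτ : τ u 0 with _ | ⟨b, v⟩
    · simpa [hτ] using this
    · cases b <;> simpa [hτ] using this
  · rintro ⟨p, q, h⟩
    refine ⟨p, q, fun u => ?_⟩
    obtain ⟨n, hn, h⟩ := h u
    exact ⟨_, n, h, hn, by simp [initStore]⟩

theorem empty_mem_sigmaP (k : ℕ) : (∅ : Set Str) ∈ SigmaP k := by
  have h : ∀ O, DecidedInPolyTime O ∅ := fun O => by
    rw [decidedInPolyTime_iff]
    convert PolyFun.const false using 2
    simp
  induction k with
  | zero => exact h _
  | succ k ih => exact ⟨fun _ => ∅, ∅, 0, fun _ => ih, h _, by simp⟩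

/-- `f` is computable in polynomial time with oracles for languages of `Σ_k^P`. -/
@[fun_prop]
def FP (k : ℕ) {α β : Type} [Enc α] [Enc β] (f : α → β) : Prop :=
  ∃ O : ℕ → Set Str, (∀ j, O j ∈ SigmaP k) ∧ PolyFun O f

theorem mem_pWithSigmaOracle_iff {k : ℕ} : L ∈ PWithSigmaOracle k ↔ FP k (charFun L) :=
  exists_congr fun _ => and_congr_right fun _ => decidedInPolyTime_iff

/-! ### Closure properties for oracles from a level of the hierarchy -/

namespace FP

variable {k : ℕ} {α β γ σ : Type} [Enc α] [Enc β] [Enc γ] [Enc σ]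

theorem of_polyFun {f : α → β} (h : ∀ O, PolyFun O f) : FP k f :=
  ⟨fun _ => ∅, fun _ => empty_mem_sigmaP k, h _⟩

theorem of_noOracle {f : α → β} (h : PolyFun noOracle f) : FP k f :=
  ⟨noOracle, fun _ => empty_mem_sigmaP k, h⟩

/-- Two oracle families are interleaved at even and odd indices; both programs then run with the
merged family after renumbering their queries. -/
theorem exists_common {f : α → β} {g : γ → σ} (hf : FP k f) (hg : FP k g) :
    ∃ O : ℕ → Set Str, (∀ j, O j ∈ SigmaP k) ∧ PolyFun O f ∧ PolyFun O g := by
  obtain ⟨O, hO, hf⟩ := hf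
  obtain ⟨O', hO', hg⟩ := hg
  refine ⟨fun j => if j % 2 = 0 then O (j / 2) else O' (j / 2), fun j => ?_,
    hf.of_oracle_subset fun j => ⟨2 * j, by simp⟩,
    hg.of_oracle_subset fun j => ⟨2 * j + 1, ?_⟩⟩
  · dsimp only
    split_ifs
    exacts [hO _, hO' _]
  · rw [if_neg (by omega)]
    congr 1
    omega

theorem length_le {f : α → β} (hf : FP k f) :
    ∃ q : Polynomial ℕ, ∀ a, (enc (f a)).length ≤ q.eval (enc a).length :=
  let ⟨_, _, h⟩ := hf
  h.length_le

@[fun_prop]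
theorem id : FP k fun a : α => a := of_polyFun fun _ => .id

@[fun_prop]
theorem const (b : β) : FP k fun _ : α => b := of_polyFun fun _ => .const b

@[fun_prop]
theorem comp {g : β → γ} {f : α → β} (hg : FP k g) (hf : FP k f) : FP k fun a => g (f a) :=
  let ⟨O, hO, hg, hf⟩ := hg.exists_common hf
  ⟨O, hO, hg.comp hf⟩

@[fun_prop]
theorem prodMk {f : α → β} {g : α → γ} (hf : FP k f) (hg : FP k g) :
    FP k fun a => (f a, g a) :=
  let ⟨O, hO, hf, hg⟩ := hf.exists_common hg
  ⟨O, hO, hf.pair hg⟩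

@[fun_prop]
theorem fst {f : α → β × γ} (hf : FP k f) : FP k fun a => (f a).1 :=
  (of_polyFun fun _ => .fst).comp hf

@[fun_prop]
theorem snd {f : α → β × γ} (hf : FP k f) : FP k fun a => (f a).2 :=
  (of_polyFun fun _ => .snd).comp hf

@[fun_prop]
theorem cons {f : α → Bool} {g : α → Str} (hf : FP k f) (hg : FP k g) :
    FP k fun a => f a :: g a := by
  obtain ⟨O, hO, hf, hg⟩ := hf.exists_common hg
  refine ⟨O, hO, ?_⟩
  convert hf.ite ((PolyFun.cons true).comp hg) ((PolyFun.cons false).comp hg) using 2 with a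
  cases f a <;> rfl

@[fun_prop]
theorem tail {f : α → Str} (hf : FP k f) : FP k fun a => (f a).tail :=
  (of_polyFun fun _ => .tail).comp hf

@[fun_prop]
theorem headD {f : α → Str} (hf : FP k f) : FP k fun a => (f a).headD false :=
  (of_polyFun fun _ => .headD).comp hf

@[fun_prop]
theorem isEmpty {f : α → Str} (hf : FP k f) : FP k fun a => (f a).isEmpty :=
  (of_polyFun fun _ => .isEmpty).comp hf

@[fun_prop]
theorem unpairStr {f : α → Str} (hf : FP k f) : FP k fun a => unpairStr (f a) := by
  have h : FP k fun u : Str => ((_root_.unpairStr u).1, (_root_.unpairStr u).2) :=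
    prodMk (of_polyFun fun _ => .unpairFst) (of_polyFun fun _ => .unpairSnd)
  exact h.comp hf

@[fun_prop]
theorem enc {f : α → β} (hf : FP k f) : FP k fun a => Enc.enc (f a) :=
  (of_polyFun fun _ => .of_enc_eq fun _ => rfl).comp hf

theorem of_enc {f : α → β} (hf : FP k fun a => Enc.enc (f a)) : FP k f := hf

@[fun_prop]
theorem pairStr {f : α → Str} {g : α → Str} (hf : FP k f) (hg : FP k g) :
    FP k fun a => pairStr (f a) (g a) := (hf.prodMk hg).enc

theorem ite_subtype {c : α → Bool} {f : {a // c a = true} → β} {g : {a // c a = false} → β}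
    {h : α → β} (hc : FP k c) (hf : FP k f) (hg : FP k g)
    (hhf : ∀ a : {a // c a = true}, h a = f a) (hhg : ∀ a : {a // c a = false}, h a = g a) :
    FP k h := by
  have h1 : FP k fun a : {a // c a = true} × {a // c a = false} => (f a.1, g a.2) := by fun_prop
  obtain ⟨O, hO, hc, hfg⟩ := hc.exists_common h1
  obtain ⟨O₁, hO₁, hf, hg⟩ := hf.exists_common hg
  refine ⟨fun j => if j % 2 = 0 then O (j / 2) else O₁ (j / 2), fun j => ?_,
    .ite_subtype (hc.of_oracle_subset fun j => ⟨2 * j, by simp⟩)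
      (hf.of_oracle_subset fun j => ⟨2 * j + 1, ?_⟩)
      (hg.of_oracle_subset fun j => ⟨2 * j + 1, ?_⟩) hhf hhg⟩
  · dsimp only
    split_ifs
    exacts [hO _, hO₁ _]
  all_goals
    rw [if_neg (by omega)]
    congr 1
    omega

@[fun_prop]
theorem cond {c : α → Bool} {f g : α → β} (hc : FP k c) (hf : FP k f) (hg : FP k g) :
    FP k fun a => bif c a then f a else g a := by
  have hval : ∀ P : α → Prop, FP k fun a : {a // P a} => a.1 := fun P =>
    of_polyFun fun _ => .of_enc_eq fun _ => rfl
  exact ite_subtype hc (hf.comp (hval _)) (hg.comp (hval _)) (fun a => by simp [a.2])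
    (fun a => by simp [a.2])

@[fun_prop]
theorem and {f g : α → Bool} (hf : FP k f) (hg : FP k g) : FP k fun a => f a && g a := by
  convert hf.cond hg (const false) using 2 with a
  cases f a <;> rfl

@[fun_prop]
theorem or {f g : α → Bool} (hf : FP k f) (hg : FP k g) : FP k fun a => f a || g a := by
  convert hf.cond (const true) hg using 2 with a
  cases f a <;> rfl

@[fun_prop]
theorem not {f : α → Bool} (hf : FP k f) : FP k fun a => !f a := by
  convert hf.cond (const false) (const true) using 2 with a
  cases f a <;> rfl

@[fun_prop]
theorem beq {f g : α → Bool} (hf : FP k f) (hg : FP k g) : FP k fun a => f a == g a := by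
  convert hf.cond hg hg.not using 2 with a
  cases f a <;> cases g a <;> rfl

theorem iterate {cnt : α → Str} {init : α → σ} {step : σ → σ} (hcnt : FP k cnt)
    (hinit : FP k init) (hstep : FP k step) (b : Polynomial ℕ)
    (hb : ∀ a, ∀ i ≤ (cnt a).length,
      (Enc.enc (step^[i] (init a))).length ≤ b.eval (Enc.enc a).length) :
    FP k fun a => step^[(cnt a).length] (init a) := by
  obtain ⟨O, hO, h, hstep⟩ := (hcnt.prodMk hinit).exists_common hstep
  exact ⟨O, hO, .iterate (PolyFun.fst.comp h) (PolyFun.snd.comp h) hstep b hb⟩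

/-- Folding is iteration on triples of unread input, parameter and state; the parameter is carried
along because the iterated step sees nothing but its state. -/
theorem foldl {l : α → Str} {init : α → σ} {step : α → σ → Bool → σ} (hl : FP k l)
    (hinit : FP k init) (hstep : FP k fun p : α × σ × Bool => step p.1 p.2.1 p.2.2)
    (b : Polynomial ℕ)
    (hb : ∀ a l', l' <+: l a →
      (Enc.enc (l'.foldl (step a) (init a))).length ≤ b.eval (Enc.enc a).length) :
    FP k fun a => (l a).foldl (step a) (init a) := by
  let next : Str × α × σ → Str × α × σ := fun p =>
    bif p.1.isEmpty then p else (p.1.tail, p.2.1, step p.2.1 p.2.2 (p.1.headD false))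
  have hnext : FP k next := by
    have : FP k fun p : Str × α × σ => step p.2.1 p.2.2 (p.1.headD false) :=
      hstep.comp (f := fun p : Str × α × σ => (p.2.1, p.2.2, p.1.headD false)) (by fun_prop)
    fun_prop
  have key : ∀ a (l : Str) s i, i ≤ l.length →
      next^[i] (l, a, s) = (l.drop i, a, (l.take i).foldl (step a) s) := by
    intro a l s i
    induction i generalizing l s with
    | zero => simp
    | succ i ih =>
        intro hi
        rcases l with _ | ⟨x, l⟩
        · simp at hi
        · rw [Function.iterate_succ_apply, show next (x :: l, a, s) = (l, a, step a s x) from rfl,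
            ih _ _ (by simpa using hi)]
          simp
  obtain ⟨r, hr⟩ := hl.length_le
  have h := iterate (cnt := l) (init := fun a => (l a, a, init a)) hl (by fun_prop) hnext
    (2 * r + (2 * .X + b + 1) + 1) (fun a i hi => by
      rw [key _ _ _ _ hi]
      have h1 := hr a
      have h2 := hb a _ ((l a).take_prefix i)
      simp [length_pairStr] at h1 h2 ⊢
      omega)
  convert h.snd.snd using 2 with a
  rw [key _ _ _ _ le_rfl]
  simp

/-- Bounded folding where each step increases the length by a constant at most. -/
theorem foldl_of_le {l : α → Str} {init : α → σ} {step : α → σ → Bool → σ} (hl : FP k l)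
    (hinit : FP k init) (hstep : FP k fun p : α × σ × Bool => step p.1 p.2.1 p.2.2)
    (K : ℕ) (hK : ∀ a s b, (Enc.enc (step a s b)).length ≤ (Enc.enc s).length + K) :
    FP k fun a => (l a).foldl (step a) (init a) := by
  obtain ⟨r, hr⟩ := hl.length_le
  obtain ⟨r', hr'⟩ := hinit.length_le
  refine foldl hl hinit hstep (r' + K * r) fun a l' hl' => ?_
  have key : ∀ (l : Str) s,
      (Enc.enc (l.foldl (step a) s)).length ≤ (Enc.enc s).length + K * l.length := by
    intro l
    induction l with
    | nil => simp
    | cons x l ih =>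
        intro s
        have h1 := ih (step a s x)
        have h2 := hK a s x
        simp [mul_add] at h1 ⊢
        omega
  have h1 := key l' (init a)
  have h2 := hr' a
  have h3 : K * l'.length ≤ K * r.eval (Enc.enc a).length :=
    Nat.mul_le_mul_left _ (hl'.length_le.trans (hr a))
  simp
  omega

end FP

theorem SigmaP.charFun {k : ℕ} (hL : L ∈ SigmaP k) : FP k (charFun L) :=
  ⟨fun _ => L, fun _ => hL, .query 0⟩

/-- Allows verifiers to be given as functions of input and certificate. The verifier language splits
its input by `unpairStr`; its behaviour on strings that are not pairs is irrelevant. -/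
theorem mem_sigmaP_succ {k : ℕ} {chk : Str × Str → Bool} (hchk : FP k chk) (q : Polynomial ℕ)
    (h : ∀ u, u ∈ L ↔ ∃ c : Str, c.length ≤ q.eval u.length ∧ chk (u, c) = true) :
    L ∈ SigmaP (k + 1) := by
  have h1 : FP k fun u : Str => chk (unpairStr u) := by fun_prop
  obtain ⟨O, hO, h1⟩ := h1
  refine ⟨O, {u | chk (unpairStr u) = true}, q, hO, ?_, fun u => by simp [h]⟩
  rw [decidedInPolyTime_iff]
  convert h1 using 1
  funext u
  cases h : chk (unpairStr u) <;> simp [h]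

/-- The verifier ignores the certificate, so the empty one suffices. -/
theorem pWithSigmaOracle_subset {k : ℕ} : PWithSigmaOracle k ⊆ SigmaP (k + 1) := by
  intro L hL
  rw [mem_pWithSigmaOracle_iff] at hL
  exact mem_sigmaP_succ (chk := fun p => charFun L p.1) (by fun_prop) 0
    fun u => by simp

theorem sigmaP_subset_succ (k : ℕ) : SigmaP k ⊆ SigmaP (k + 1) := fun _ hL =>
  pWithSigmaOracle_subset (mem_pWithSigmaOracle_iff.2 (SigmaP.charFun hL))

theorem sigmaP_mono : Monotone SigmaP := monotone_nat_of_le_succ sigmaP_subset_succ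

theorem FP.mono {k k' : ℕ} {α β : Type} [Enc α] [Enc β] {f : α → β} (hf : FP k f)
    (h : k ≤ k') : FP k' f :=
  let ⟨O, hO, hf⟩ := hf
  ⟨O, fun j => sigmaP_mono h (hO j), hf⟩

end

/-! ## Strings and binary arithmetic in polynomial time -/

/-- Replace all bits by `true`: the unary code of the length. -/
def ones (u : Str) : Str := List.replicate u.length true

theorem Nat.length_bits_div_two_le (n : ℕ) : (n / 2).bits.length ≤ n.bits.length := by
  rw [Nat.size_eq_bits_len, Nat.size_eq_bits_len]
  exact Nat.size_le_size (Nat.div_le_self _ _)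

theorem Nat.bits_eq_nil {n : ℕ} : n.bits = [] ↔ n = 0 := by
  rw [← List.length_eq_zero_iff, Nat.size_eq_bits_len, Nat.size_eq_zero]

theorem Nat.bits_bit (b : Bool) (n : ℕ) :
    (Nat.bit b n).bits = bif !b && n.bits.isEmpty then [] else b :: n.bits := by
  by_cases h : n = 0 → b = true
  · rw [Nat.bits_append_bit n b h]
    cases b
    · have : n ≠ 0 := by simpa using h
      have : n.bits.isEmpty = false := by simpa [Nat.bits_eq_nil] using this
      simp [this]
    · simp
  · push Not at h
    obtain ⟨rfl, hb⟩ := h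
    simp at hb
    simp [hb]

theorem Nat.foldl_bit_reverse_bits (n : ℕ) :
    n.bits.reverse.foldl (fun n b => Nat.bit b n) 0 = n := by
  rw [List.foldl_reverse]
  induction n using Nat.binaryRec' with
  | zero => simp
  | bit b n h ih => rw [Nat.bits_append_bit n b h, List.foldr_cons, ih]

theorem Nat.foldl_bit_lt (l : Str) (n : ℕ) (m : ℕ) (h : n < 2 ^ m) :
    l.foldl (fun n b => Nat.bit b n) n < 2 ^ (m + l.length) := by
  induction l generalizing n m with
  | nil => simpa
  | cons b l ih =>
      rw [List.foldl_cons, List.length_cons, add_comm l.length, ← add_assoc]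
      refine ih _ _ ?_
      rwa [Nat.bit_lt_two_pow_succ_iff]

/-! ### String operations, unary polynomials and binary digits -/

namespace FP

variable {k : ℕ} {α β γ σ : Type} [Enc α] [Enc β] [Enc γ] [Enc σ]

@[fun_prop]
theorem reverse {f : α → Str} (hf : FP k f) : FP k fun a => (f a).reverse := by
  have := foldl_of_le (step := fun _ s b => b :: s) hf (const []) (by fun_prop) 1 (by simp)
  simpa using this

@[fun_prop]
theorem append {f g : α → Str} (hf : FP k f) (hg : FP k g) : FP k fun a => f a ++ g a := by
  have := foldl_of_le (step := fun _ s b => b :: s) hf.reverse hg (by fun_prop) 1 (by simp)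
  convert this using 2 with a
  simp [List.foldl_reverse]

@[fun_prop]
theorem ones {f : α → Str} (hf : FP k f) : FP k fun a => ones (f a) := by
  have := foldl_of_le (step := fun _ s _ => true :: s) hf (const []) (by fun_prop) 1 (by simp)
  convert this using 2 with a
  have : ∀ (l s : Str), l.foldl (fun s _ => true :: s) s = List.replicate l.length true ++ s := by
    intro l
    induction l with
    | nil => simp
    | cons b l ih =>
        intro s
        rw [List.foldl_cons, ih, List.length_cons, List.replicate_succ', List.append_assoc]
        rfl
  simp [this, _root_.ones]

@[fun_prop]
theorem decide_eq {f g : α → Str} (hf : FP k f) (hg : FP k g) :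
    FP k fun a => decide (f a = g a) := by
  have := foldl_of_le (σ := Str × Bool) (step := fun _ s b =>
    (s.1.tail, s.2 && (!s.1.isEmpty && (s.1.headD false == b))))
    hf (hg.prodMk (const true)) (by fun_prop) 0 (by simp [length_pairStr])
  have h2 : FP k fun s : Str × Bool => s.2 && s.1.isEmpty := by fun_prop
  convert h2.comp this using 2 with a
  have : ∀ (l s : Str) (ok : Bool), (ok && decide (l = s)) = ((l.foldl (fun (s : Str × Bool) b =>
      (s.1.tail, s.2 && (!s.1.isEmpty && (s.1.headD false == b)))) (s, ok)).2 &&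
      (l.foldl (fun (s : Str × Bool) b =>
      (s.1.tail, s.2 && (!s.1.isEmpty && (s.1.headD false == b)))) (s, ok)).1.isEmpty) := by
    intro l
    induction l with
    | nil => intro s ok; cases s <;> simp
    | cons b l ih =>
        intro s ok
        rw [List.foldl_cons, ← ih]
        rcases s with _ | ⟨x, s⟩
        · simp
        · cases ok <;> cases b <;> cases x <;> simp <;> congr
  rw [← this]
  simp

/-- Appending a unary copy of `g a` once for each bit of `f a` multiplies lengths; with it,
polynomial bounds can be written out in unary. -/
theorem mul_ones {f g : α → Str} (hf : FP k f) (hg : FP k g) :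
    FP k fun a => List.replicate ((f a).length * (g a).length) true := by
  obtain ⟨r, hr⟩ := hf.length_le
  obtain ⟨r', hr'⟩ := hg.length_le
  have key : ∀ (v l s : Str),
      l.foldl (fun s _ => _root_.ones v ++ s) s =
        List.replicate (l.length * v.length) true ++ s := by
    intro v l
    induction l with
    | nil => simp
    | cons b l ih =>
        intro s
        rw [List.foldl_cons, ih, List.length_cons, add_mul, one_mul,
          ← List.replicate_append_replicate, List.append_assoc, _root_.ones]
  have := foldl (step := fun a s _ => _root_.ones (g a) ++ s) hf (const []) (by fun_prop) (r * r')
    (by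
      intro a l' hl'
      rw [key]
      have := hl'.length_le.trans (hr a)
      have h' := hr' a
      simp at h' ⊢
      gcongr)
  convert this using 2 with a
  rw [key]
  simp

/-- Polynomials of the length can be computed in unary. -/
theorem polynomial_length (q : Polynomial ℕ) {f : α → Str} (hf : FP k f) :
    FP k fun a => List.replicate (q.eval (f a).length) true := by
  induction q using Polynomial.induction_on' with
  | add p q hp hq =>
      simp only [Polynomial.eval_add, ← List.replicate_append_replicate]
      fun_prop
  | monomial n c =>
      simp only [Polynomial.eval_monomial]
      induction n with
      | zero => simp; fun_prop
      | succ n ih =>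
          have := mul_ones ih hf
          simpa [pow_succ, mul_assoc] using this

/-! ### Natural numbers -/

@[fun_prop]
theorem div_two {f : α → ℕ} (hf : FP k f) : FP k fun a => f a / 2 := by
  have h : FP k fun n : ℕ => n / 2 := of_enc <| by
    have : FP k fun n : ℕ => (Enc.enc n).tail := by fun_prop
    simpa [← Nat.div2_bits_eq_tail, Nat.div2_val] using this
  exact h.comp hf

@[fun_prop]
theorem bodd {f : α → ℕ} (hf : FP k f) : FP k fun a => (f a).bodd := by
  have h : FP k fun n : ℕ => n.bodd := by
    have : FP k fun n : ℕ => (Enc.enc n).headD false := by fun_prop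
    convert this using 2 with n
    rw [Nat.bodd_eq_bits_head]
    simp
    cases n.bits <;> rfl
  exact h.comp hf

@[fun_prop]
theorem bit {f : α → Bool} {g : α → ℕ} (hf : FP k f) (hg : FP k g) :
    FP k fun a => Nat.bit (f a) (g a) := by
  have h : FP k fun p : Bool × ℕ => Nat.bit p.1 p.2 := of_enc <| by
    have : FP k fun p : Bool × ℕ =>
      bif !p.1 && (Enc.enc p.2).isEmpty then [] else p.1 :: Enc.enc p.2 := by fun_prop
    simpa [Nat.bits_bit] using this
  exact h.comp (hf.prodMk hg)

/-- The number with the given binary digits, the most significant one first. -/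
theorem foldl_bit {f : α → Str} (hf : FP k f) :
    FP k fun a => (f a).foldl (fun n b => Nat.bit b n) 0 :=
  foldl_of_le (step := fun _ n b => Nat.bit b n) hf (const 0) (by fun_prop) 1
    fun _ n b => by
      simp only [enc_nat, Nat.bits_bit]
      cases b <;> cases n.bits <;> simp

@[fun_prop]
theorem decide_eq_zero {f : α → ℕ} (hf : FP k f) : FP k fun a => decide (f a = 0) := by
  have : FP k fun a => decide (Enc.enc (f a) = []) := by fun_prop
  convert this using 3 with a
  simp [Nat.bits_eq_nil]

end FP

/-- One step of the addition of `s.1` and `s.2.1` with the carry `s.2.2.1`. -/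
def addStep (s : ℕ × ℕ × Bool × Str) : ℕ × ℕ × Bool × Str :=
  (s.1 / 2, s.2.1 / 2,
    (s.1.bodd && s.2.1.bodd) || ((s.1.bodd || s.2.1.bodd) && s.2.2.1),
    ((s.1.bodd == s.2.1.bodd) == s.2.2.1) :: s.2.2.2)

/-- What is still to be added. -/
def addTotal (s : ℕ × ℕ × Bool × Str) : ℕ := s.1 + s.2.1 + s.2.2.1.toNat

theorem addTotal_eq (s : ℕ × ℕ × Bool × Str) :
    addTotal s = Nat.bit ((s.1.bodd == s.2.1.bodd) == s.2.2.1) (addTotal (addStep s)) := by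
  obtain ⟨a, b, c, acc⟩ := s
  have ha := Nat.mod_two_of_bodd a
  have hb := Nat.mod_two_of_bodd b
  simp only [addTotal, addStep, Nat.bit_val]
  cases h1 : a.bodd <;> cases h2 : b.bodd <;> cases c <;> simp [h1, h2] at * <;> omega

/-- Each step halves what is still to be added and puts the bit that is split off on the
accumulator. Evaluating the accumulator by Horner's rule, starting from the remaining total,
therefore always gives the same number. -/
theorem foldl_addStep (l : Str) (s : ℕ × ℕ × Bool × Str) :
    let t := l.foldl (fun s _ => addStep s) s
    addTotal t = addTotal s / 2 ^ l.length ∧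
      t.2.2.2.foldl (fun n b => Nat.bit b n) (addTotal t) =
        s.2.2.2.foldl (fun n b => Nat.bit b n) (addTotal s) := by
  induction l generalizing s with
  | nil => simp
  | cons x l ih =>
      obtain ⟨h1, h2⟩ := ih (addStep s)
      have h3 := addTotal_eq s
      simp only [List.foldl_cons]
      refine ⟨h1.trans ?_, h2.trans ?_⟩
      · rw [List.length_cons, pow_succ', ← Nat.div_div_eq_div_mul]
        conv_rhs => rw [h3]
        rw [Nat.bit_div_two]
      · conv_rhs => rw [h3]
        rfl

/-- One step of the subtraction of `s.2.1` from `s.1` with the borrow `s.2.2.1`. -/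
def subStep (s : ℕ × ℕ × Bool × Str) : ℕ × ℕ × Bool × Str :=
  (s.1 / 2, s.2.1 / 2,
    (!s.1.bodd && (s.2.1.bodd || s.2.2.1)) || (s.2.1.bodd && s.2.2.1),
    ((s.1.bodd == s.2.1.bodd) == s.2.2.1) :: s.2.2.2)

/-- The difference that is still to be computed. -/
def subTotal (s : ℕ × ℕ × Bool × Str) : ℤ := s.1 - s.2.1 - s.2.2.1.toNat

/-- The integer version of `Nat.bit`. -/
def intBit (z : ℤ) (b : Bool) : ℤ := 2 * z + b.toNat

theorem foldl_intBit_natCast (l : Str) (n : ℕ) :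
    l.foldl intBit n = (l.foldl (fun n b => Nat.bit b n) n : ℕ) := by
  induction l generalizing n with
  | nil => rfl
  | cons b l ih => rw [List.foldl_cons, List.foldl_cons, ← ih, intBit, Nat.bit_val]; simp

theorem subTotal_eq (s : ℕ × ℕ × Bool × Str) :
    subTotal s = intBit (subTotal (subStep s)) ((s.1.bodd == s.2.1.bodd) == s.2.2.1) := by
  obtain ⟨a, b, c, acc⟩ := s
  have ha := Nat.mod_two_of_bodd a
  have hb := Nat.mod_two_of_bodd b
  simp only [subTotal, subStep, intBit]
  cases h1 : a.bodd <;> cases h2 : b.bodd <;> cases c <;> simp [h1, h2] at * <;> omega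

/-- The invariant of addition, now over the integers because of the borrow: the remaining difference
can be negative, and halving rounds it down. -/
theorem foldl_subStep (l : Str) (s : ℕ × ℕ × Bool × Str) :
    let t := l.foldl (fun s _ => subStep s) s
    t.1 = s.1 / 2 ^ l.length ∧ t.2.1 = s.2.1 / 2 ^ l.length ∧
    subTotal t = subTotal s / 2 ^ l.length ∧
      t.2.2.2.foldl intBit (subTotal t) = s.2.2.2.foldl intBit (subTotal s) := by
  induction l generalizing s with
  | nil => simp
  | cons x l ih =>
      obtain ⟨h0, h0', h1, h2⟩ := ih (subStep s)
      have h3 := subTotal_eq s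
      simp only [List.foldl_cons]
      refine ⟨h0.trans ?_, h0'.trans ?_, h1.trans ?_, h2.trans ?_⟩
      · rw [List.length_cons, pow_succ', ← Nat.div_div_eq_div_mul]; rfl
      · rw [List.length_cons, pow_succ', ← Nat.div_div_eq_div_mul]; rfl
      · have h4 : subTotal s / 2 = subTotal (subStep s) := by
          rw [h3, intBit]
          have := Bool.toNat_le ((s.1.bodd == s.2.1.bodd) == s.2.2.1)
          omega
        rw [List.length_cons, pow_succ', ← Int.ediv_ediv_of_nonneg (by norm_num), h4]
      · conv_rhs => rw [h3]
        rfl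

namespace FP

variable {k : ℕ} {α β γ σ : Type} [Enc α] [Enc β] [Enc γ] [Enc σ]

@[fun_prop]
theorem add {f g : α → ℕ} (hf : FP k f) (hg : FP k g) : FP k fun a => f a + g a := by
  -- The folded string merely counts rounds. The additional bit provides for a sum that has one
  -- digit more, so that nothing remains to be added at the end.
  have h := foldl_of_le (l := fun a => Enc.enc (f a) ++ Enc.enc (g a) ++ [true])
    (init := fun a => (f a, g a, false, ([] : Str))) (step := fun _ s _ => addStep s)
    (by fun_prop) (by fun_prop) (by unfold addStep; fun_prop) 1 (fun _ s _ => by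
      have h1 := s.1.length_bits_div_two_le
      have h2 := s.2.1.length_bits_div_two_le
      simp [addStep, length_pairStr]
      omega)
  convert foldl_bit h.snd.snd.snd using 2 with a
  obtain ⟨h1, h2⟩ := foldl_addStep (Enc.enc (f a) ++ Enc.enc (g a) ++ [true])
    (f a, g a, false, [])
  rw [Nat.div_eq_of_lt] at h1
  · rw [h1] at h2
    simpa [addTotal] using h2.symm
  · have h3 := (f a).lt_size_self
    have h4 := (g a).lt_size_self
    have h5 : 2 ^ (f a).size ≤ 2 ^ ((f a).size + (g a).size) := by gcongr <;> omega
    have h6 : 2 ^ (g a).size ≤ 2 ^ ((f a).size + (g a).size) := by gcongr <;> omega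
    simp only [addTotal, enc_nat, List.length_append, Nat.size_eq_bits_len, List.length_singleton,
      pow_succ, Bool.toNat_false]
    omega

theorem foldl_subStep {f g : α → ℕ} (hf : FP k f) (hg : FP k g) :
    FP k fun a => (Enc.enc (f a) ++ Enc.enc (g a)).foldl (fun s _ => subStep s)
      (f a, g a, false, ([] : Str)) :=
  foldl_of_le (step := fun _ s _ => subStep s)
    (by fun_prop) (by fun_prop) (by unfold subStep; fun_prop) 1 (fun _ s _ => by
      have h1 := s.1.length_bits_div_two_le
      have h2 := s.2.1.length_bits_div_two_le
      simp [subStep, length_pairStr]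
      omega)

end FP

/-- There are enough rounds to reduce both operands to zero, so minus the final borrow is all that
is left of the difference. Since this equals `a - b` divided by a power of two and rounded down, the
borrow is set exactly if `a < b`. -/
theorem foldl_subStep_spec (a b : ℕ) :
    let t := (Enc.enc a ++ Enc.enc b).foldl (fun s _ => subStep s) (a, b, false, [])
    t.2.2.1 = decide (a < b) ∧
      (b ≤ a → t.2.2.2.foldl (fun n b => Nat.bit b n) 0 = a - b) := by
  intro t
  obtain ⟨h1, h2, h3, h4⟩ := foldl_subStep (Enc.enc a ++ Enc.enc b) (a, b, false, [])
  have ha := a.lt_size_self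
  have hb := b.lt_size_self
  have h5 : 2 ^ a.size ≤ 2 ^ (a.size + b.size) := by gcongr <;> omega
  have h6 : 2 ^ b.size ≤ 2 ^ (a.size + b.size) := by gcongr <;> omega
  simp only [enc_nat, List.length_append, Nat.size_eq_bits_len] at h1 h2 h3
  rw [Nat.div_eq_of_lt (by omega)] at h1 h2
  change t.1 = 0 at h1
  change t.2.1 = 0 at h2
  change subTotal t = _ at h3
  change t.2.2.2.foldl intBit (subTotal t) = _ at h4
  have h7 : subTotal t = - t.2.2.1.toNat := by simp [subTotal, h1, h2]
  have h8 : subTotal (a, b, false, []) = a - b := by simp [subTotal]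
  rw [h8] at h3 h4
  have h9 : t.2.2.1 = decide (a < b) := by
    by_cases hab : a < b
    · have h10 : ((a : ℤ) - b) / 2 ^ (a.size + b.size) < 0 :=
        Int.ediv_neg_of_neg_of_pos (by omega) (by positivity)
      cases hc : t.2.2.1
      · simp [hc] at h7; omega
      · simp [hab]
    · have h10 : 0 ≤ ((a : ℤ) - b) / 2 ^ (a.size + b.size) :=
        Int.ediv_nonneg (by omega) (by positivity)
      cases hc : t.2.2.1
      · simp [hab]
      · simp [hc] at h7; omega
  refine ⟨h9, fun hab => ?_⟩
  rw [h7, h9, decide_eq_false (by omega), Bool.toNat_false, Nat.cast_zero, neg_zero,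
    ← Nat.cast_zero, foldl_intBit_natCast] at h4
  simp at h4
  omega

namespace FP

variable {k : ℕ} {α β γ σ : Type} [Enc α] [Enc β] [Enc γ] [Enc σ]

@[fun_prop]
theorem decide_lt {f g : α → ℕ} (hf : FP k f) (hg : FP k g) :
    FP k fun a => decide (f a < g a) := by
  convert (foldl_subStep hf hg).snd.snd.fst using 2 with a
  exact (foldl_subStep_spec _ _).1.symm

@[fun_prop]
theorem sub {f g : α → ℕ} (hf : FP k f) (hg : FP k g) : FP k fun a => f a - g a := by
  have h : FP k fun a => bif decide (f a < g a) then 0 else ((Enc.enc (f a) ++ Enc.enc (g a)).foldl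
      (fun s _ => subStep s) (f a, g a, false, ([] : Str))).2.2.2.foldl
        (fun n b => Nat.bit b n) 0 :=
    (decide_lt hf hg).cond (const 0) (foldl_bit (foldl_subStep hf hg).snd.snd.snd)
  convert h using 2 with a
  by_cases hab : f a < g a
  · simp [hab]; omega
  · rw [(foldl_subStep_spec _ _).2 (by omega)]
    simp [hab]

@[fun_prop]
-- Horner's rule on the digits of the first factor, the most significant one first. Each partial
-- result is a prefix of this factor times the second one, so its length is at most the sum of the
-- lengths.
theorem mul {f g : α → ℕ} (hf : FP k f) (hg : FP k g) : FP k fun a => f a * g a := by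
  have key : ∀ (c : ℕ) (l : Str) (n : ℕ),
      l.foldl (fun r b => Nat.bit false r + bif b then c else 0) (n * c) =
        l.foldl (fun n b => Nat.bit b n) n * c := by
    intro c l
    induction l with
    | nil => simp
    | cons b l ih =>
        intro n
        rw [List.foldl_cons, List.foldl_cons, ← ih]
        congr 1
        cases b <;> simp [Nat.bit_val] <;> ring
  obtain ⟨r, hr⟩ := hf.length_le
  obtain ⟨r', hr'⟩ := hg.length_le
  have h := foldl (l := fun a => (Enc.enc (f a)).reverse) (init := fun _ => 0)
    (step := fun a r b => Nat.bit false r + bif b then g a else 0)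
    (by fun_prop) (by fun_prop) (by fun_prop) (r + r') (fun a l' hl' => by
      have := key (g a) l' 0
      rw [zero_mul] at this
      rw [this]
      have h1 := Nat.foldl_bit_lt l' 0 0 (by simp)
      have h2 := (g a).lt_size_self
      have h3 := hl'.length_le.trans_eq (List.length_reverse)
      have h4 := hr a
      have h5 := hr' a
      simp only [enc_nat, Nat.size_eq_bits_len, Polynomial.eval_add] at h3 h4 h5 ⊢
      refine (Nat.size_le.2 ?_).trans (add_le_add (h3.trans h4) h5)
      rw [pow_add]
      rw [zero_add] at h1
      exact Nat.mul_lt_mul'' h1 h2)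
  convert h using 2 with a
  have := key (g a) (Enc.enc (f a)).reverse 0
  rw [zero_mul, enc_nat, Nat.foldl_bit_reverse_bits] at this
  exact this.symm

/-- Powers of two with exponents in unary. -/
theorem two_pow {f : α → Str} (hf : FP k f) : FP k fun a => 2 ^ (f a).length := by
  convert foldl_bit ((const [true]).append
    (foldl_of_le (step := fun _ s _ => false :: s) hf (const []) (by fun_prop) 1 (by simp)))
    using 2 with a
  have h1 : ∀ l s : Str, l.foldl (fun s _ => false :: s) s = List.replicate l.length false ++ s := by
    intro l
    induction l with
    | nil => simp
    | cons b l ih =>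
        intro s
        rw [List.foldl_cons, ih, List.length_cons, List.replicate_succ', List.append_assoc]
        rfl
  have h2 : ∀ m n : ℕ, (List.replicate m false).foldl (fun n b => Nat.bit b n) n = 2 ^ m * n := by
    intro m
    induction m with
    | zero => simp
    | succ m ih => intro n; rw [List.replicate_succ, List.foldl_cons, ih, Nat.bit_val]; simp; ring
  simp [h1, h2]

/-! ### Integers -/

@[fun_prop]
theorem decide_neg {f : α → ℤ} (hf : FP k f) : FP k fun a => decide (f a < 0) := by
  have : FP k fun a => (Enc.enc (f a)).headD false := by fun_prop
  simpa [intStr] using this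

@[fun_prop]
theorem natAbs {f : α → ℤ} (hf : FP k f) : FP k fun a => (f a).natAbs := by
  have : FP k fun a => (Enc.enc (f a)).tail := by fun_prop
  exact of_enc (by simpa [intStr] using this)

@[fun_prop]
theorem natCast {f : α → ℕ} (hf : FP k f) : FP k fun a => (f a : ℤ) := by
  have : FP k fun a => false :: Enc.enc (f a) := by fun_prop
  refine of_enc ?_
  convert this using 2 with a
  simp [intStr]

@[fun_prop]
theorem neg {f : α → ℤ} (hf : FP k f) : FP k fun a => - f a := by
  -- Zero has to keep the sign bit `false`, hence the second test.
  have : FP k fun a => (!decide (f a < 0) && !decide ((f a).natAbs = 0)) :: Enc.enc (f a).natAbs := by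
    fun_prop
  refine of_enc ?_
  convert this using 2 with a
  simp [intStr]
  rcases lt_trichotomy (f a) 0 with h | h | h
  · simp [h, h.le]
  · simp [h]
  · simp [h, h.le, h.ne']

@[fun_prop]
theorem int_add {f g : α → ℤ} (hf : FP k f) (hg : FP k g) : FP k fun a => f a + g a := by
  have : FP k fun a =>
      bif decide (f a < 0) == decide (g a < 0) then
        bif decide (f a < 0) then -(((f a).natAbs + (g a).natAbs : ℕ) : ℤ)
        else (((f a).natAbs + (g a).natAbs : ℕ) : ℤ)
      else bif decide (f a < 0) then
        bif decide ((f a).natAbs < (g a).natAbs) then (((g a).natAbs - (f a).natAbs : ℕ) : ℤ)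
        else -(((f a).natAbs - (g a).natAbs : ℕ) : ℤ)
      else
        bif decide ((g a).natAbs < (f a).natAbs) then (((f a).natAbs - (g a).natAbs : ℕ) : ℤ)
        else -(((g a).natAbs - (f a).natAbs : ℕ) : ℤ) := by fun_prop
  convert this using 2 with a
  by_cases h1 : f a < 0 <;> by_cases h2 : g a < 0 <;>
    by_cases h3 : (f a).natAbs < (g a).natAbs <;> by_cases h4 : (g a).natAbs < (f a).natAbs <;>
    simp only [h1, h2, h3, h4, decide_true, decide_false, Bool.cond_true, Bool.cond_false,
      beq_self_eq_true, show (true == false) = false from rfl,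
      show (false == true) = false from rfl] <;> omega

@[fun_prop]
theorem int_mul_nat {f : α → ℤ} {g : α → ℕ} (hf : FP k f) (hg : FP k g) :
    FP k fun a => f a * (g a : ℤ) := by
  have : FP k fun a => bif decide (f a < 0) then -(((f a).natAbs * g a : ℕ) : ℤ)
      else (((f a).natAbs * g a : ℕ) : ℤ) := by fun_prop
  convert this using 2 with a
  by_cases h : f a < 0
  · have h' : ((f a).natAbs : ℤ) = - f a := by omega
    simp [h]
    rw [abs_of_neg h]; ring
  · simp [h]
    exact Or.inl (abs_of_nonneg (by omega)).symm

@[fun_prop]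
theorem int_decide_lt {f g : α → ℤ} (hf : FP k f) (hg : FP k g) :
    FP k fun a => decide (f a < g a) := by
  have : FP k fun a => decide (f a + - g a < 0) := by fun_prop
  convert this using 3 with a
  omega

end FP

/-! ## Fractions -/

/-- The rational number represented by a numerator and a denominator. -/
def fracVal (q : ℤ × ℕ) : ℚ := (q.1 : ℚ) / (q.2 : ℚ)

theorem codes_rat_iff {u : Str} {x : ℚ} :
    Coding.Codes u x ↔ ∃ q : ℤ × ℕ, 0 < q.2 ∧ x = fracVal q ∧ u = enc q :=
  ⟨fun ⟨z, d, h⟩ => ⟨(z, d), h⟩, fun ⟨q, h⟩ => ⟨q.1, q.2, h⟩⟩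

theorem codes_fracVal {q : ℤ × ℕ} (hq : 0 < q.2) : Coding.Codes (enc q) (fracVal q) :=
  codes_rat_iff.2 ⟨q, hq, rfl, rfl⟩

/-- The number with the given binary digits, the least significant one first. -/
def parseNat (u : Str) : ℕ := u.reverse.foldl (fun n b => Nat.bit b n) 0

/-- The fraction with the given code (with arbitrary values on strings that are not codes). -/
def parseFrac (u : Str) : ℤ × ℕ :=
  (bif (unpairStr u).1.headD false then -(parseNat (unpairStr u).1.tail : ℤ)
    else (parseNat (unpairStr u).1.tail : ℤ), parseNat (unpairStr u).2)

theorem parseNat_bits (n : ℕ) : parseNat n.bits = n := Nat.foldl_bit_reverse_bits n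

@[simp] theorem parseFrac_enc (q : ℤ × ℕ) : parseFrac (enc q) = q := by
  obtain ⟨z, d⟩ := q
  by_cases hz : z < 0
  · simp [parseFrac, intStr, parseNat_bits, hz, abs_of_neg hz]
  · simp [parseFrac, intStr, parseNat_bits, hz, abs_of_nonneg (not_lt.1 hz)]

/-- Parsing and writing again reproduces a string only if it has the form of a fraction; together
with a positive denominator this is a test for codes that a program can carry out. -/
theorem codes_rat_iff_parseFrac {u : Str} {x : ℚ} :
    Coding.Codes u x ↔ u = enc (parseFrac u) ∧ 0 < (parseFrac u).2 ∧ x = fracVal (parseFrac u) := by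
  rw [codes_rat_iff]
  constructor
  · rintro ⟨q, hq, rfl, rfl⟩
    simp only [parseFrac_enc]
    exact ⟨trivial, hq, trivial⟩
  · rintro ⟨h1, h2, h3⟩
    exact ⟨_, h2, h3, h1⟩

/-- Addition of fractions. -/
def fracAdd (p q : ℤ × ℕ) : ℤ × ℕ := (p.1 * (q.2 : ℤ) + q.1 * (p.2 : ℤ), p.2 * q.2)

/-- Comparison of fractions. -/
def fracLt (p q : ℤ × ℕ) : Bool := decide (p.1 * (q.2 : ℤ) < q.1 * (p.2 : ℤ))

/-- Decrease a fraction a bit, depending on a bound `D` on the denominators of other fractions. -/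
def fracPred (q : ℤ × ℕ) (D : ℕ) : ℤ × ℕ := fracAdd q (-1, q.2 * D)

theorem fracAdd_snd_pos {p q : ℤ × ℕ} (hp : 0 < p.2) (hq : 0 < q.2) : 0 < (fracAdd p q).2 :=
  Nat.mul_pos hp hq

theorem fracVal_fracAdd {p q : ℤ × ℕ} (hp : 0 < p.2) (hq : 0 < q.2) :
    fracVal (fracAdd p q) = fracVal p + fracVal q := by
  have hp' : (p.2 : ℚ) ≠ 0 := by positivity
  have hq' : (q.2 : ℚ) ≠ 0 := by positivity
  simp only [fracVal, fracAdd]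
  push_cast
  field_simp

theorem fracLt_iff {p q : ℤ × ℕ} (hp : 0 < p.2) (hq : 0 < q.2) :
    fracLt p q = true ↔ fracVal p < fracVal q := by
  have hp' : (0 : ℚ) < p.2 := by positivity
  have hq' : (0 : ℚ) < q.2 := by positivity
  rw [fracLt, decide_eq_true_eq, fracVal, fracVal, div_lt_div_iff₀ hp' hq']
  norm_cast

theorem fracPred_snd_pos {q : ℤ × ℕ} {D : ℕ} (hq : 0 < q.2) (hD : 0 < D) :
    0 < (fracPred q D).2 := fracAdd_snd_pos hq (Nat.mul_pos hq hD)

/-- Distinct fractions with denominators `p.2` and `q.2` differ by at least `1 / (q.2 * p.2)`, hence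
by at least `1 / (q.2 * D)`, which is just what `fracPred` subtracts. Strict improvement thereby
becomes a question with a nonstrict bound. -/
theorem le_fracVal_fracPred_iff {p q : ℤ × ℕ} {D : ℕ} (hp : 0 < p.2) (hq : 0 < q.2)
    (hD : p.2 ≤ D) : fracVal p ≤ fracVal (fracPred q D) ↔ fracVal p < fracVal q := by
  have hp' : (0 : ℚ) < p.2 := by positivity
  have hq' : (0 : ℚ) < q.2 := by positivity
  have hD' : (0 : ℚ) < D := by exact_mod_cast hp.trans_le hD
  have hpD : (p.2 : ℚ) ≤ D := by exact_mod_cast hD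
  rw [fracPred, fracVal_fracAdd hq (Nat.mul_pos hq (hp.trans_le hD))]
  have hneg : fracVal (-1, q.2 * D) = - (1 / (q.2 * D : ℚ)) := by
    simp [fracVal, neg_div]
  have hpos : (0 : ℚ) < 1 / (q.2 * D : ℚ) := by positivity
  rw [hneg]
  refine ⟨fun h => by linarith, fun h => ?_⟩
  have h1 : p.1 * (q.2 : ℤ) + 1 ≤ q.1 * (p.2 : ℤ) := by
    have := (fracLt_iff hp hq).2 h
    rw [fracLt, decide_eq_true_eq] at this
    omega
  have h2 : (p.1 : ℚ) * q.2 + 1 ≤ q.1 * p.2 := by exact_mod_cast h1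
  have h3 : 1 / (q.2 * D : ℚ) ≤ 1 / (q.2 * p.2 : ℚ) := by gcongr
  have h4 : fracVal p + 1 / (q.2 * p.2 : ℚ) ≤ fracVal q := by
    simp only [fracVal]
    rw [div_add_div _ _ hp'.ne' (by positivity), div_le_div_iff₀ (by positivity) hq']
    nlinarith [mul_le_mul_of_nonneg_right h2 (mul_pos hp' hq').le]
  linarith

namespace FP

variable {k : ℕ} {α β γ σ : Type} [Enc α] [Enc β] [Enc γ] [Enc σ]

@[fun_prop]
theorem parseNat {f : α → Str} (hf : FP k f) : FP k fun a => parseNat (f a) := foldl_bit hf.reverse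

@[fun_prop]
theorem parseFrac {f : α → Str} (hf : FP k f) : FP k fun a => parseFrac (f a) := by
  unfold _root_.parseFrac
  fun_prop

@[fun_prop]
theorem fracAdd {f g : α → ℤ × ℕ} (hf : FP k f) (hg : FP k g) :
    FP k fun a => fracAdd (f a) (g a) := by
  unfold _root_.fracAdd
  fun_prop

@[fun_prop]
theorem fracLt {f g : α → ℤ × ℕ} (hf : FP k f) (hg : FP k g) :
    FP k fun a => fracLt (f a) (g a) := by
  unfold _root_.fracLt
  fun_prop

@[fun_prop]
theorem fracPred {f : α → ℤ × ℕ} {g : α → ℕ} (hf : FP k f) (hg : FP k g) :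
    FP k fun a => fracPred (f a) (g a) := by
  unfold _root_.fracPred
  fun_prop

/-- Bounded universal quantification with a bound in unary. -/
theorem forall_lt {l : α → Str} {c : Str × α → Bool} (hl : FP k l) (hc : FP k c) :
    FP k fun a => decide (∀ i < (l a).length, c (List.replicate i true, a) = true) := by
  have h := foldl_of_le (init := fun _ => (true, ([] : Str)))
    (step := fun a s _ => (s.1 && c (s.2, a), true :: s.2)) hl (by fun_prop) (by fun_prop) 1
    (by simp [length_pairStr]; omega)
  have key : ∀ a (l : Str) (ok : Bool) (j : ℕ),
      ((l.foldl (fun s _ => (s.1 && c (s.2, a), true :: s.2))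
        (ok, List.replicate j true)).1 = true ↔
      ok = true ∧ ∀ i < l.length, c (List.replicate (j + i) true, a) = true) := by
    intro a l
    induction l with
    | nil => simp
    | cons x l ih =>
        intro ok j
        rw [List.foldl_cons, ← List.replicate_succ, ih, Bool.and_eq_true, and_assoc,
          List.length_cons, Nat.forall_lt_succ_left]
        simp [add_right_comm, ← add_assoc]
  convert h.fst using 2 with a
  rw [Bool.eq_iff_iff]
  have := key a (l a) true 0
  simp only [List.replicate_zero] at this
  rw [this]
  simp

end FP

/-! ## Codes -/

theorem PolyTime.exists_code_length_le {α β : Type} [Coding α] [Coding β] {f : α → β}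
    (hf : PolyTime f) : ∃ q : Polynomial ℕ, ∀ a u, Coding.Codes u a →
      ∃ v, Coding.Codes v (f a) ∧ v.length ≤ q.eval u.length := by
  obtain ⟨p, q, h⟩ := hf
  refine ⟨.X + q, fun a u hu => ?_⟩
  obtain ⟨τ, n, h1, h2, h3⟩ := h a u hu
  refine ⟨_, h3, ?_⟩
  have := h1.length_le 0
  simp [initStore] at this ⊢
  omega

/-- The denominators of rational values that can be computed in polynomial time. -/
theorem PolyTime.exists_fracVal_eq {α : Type} [Coding α] {f : α → ℚ} (hf : PolyTime f) :
    ∃ q : Polynomial ℕ, ∀ a u, Coding.Codes u a →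
      ∃ x : ℤ × ℕ, 0 < x.2 ∧ f a = fracVal x ∧ x.2 ≤ 2 ^ q.eval u.length := by
  obtain ⟨q, h⟩ := hf.exists_code_length_le
  refine ⟨q, fun a u hu => ?_⟩
  obtain ⟨v, hv, hvq⟩ := h a u hu
  obtain ⟨x, hx, hfx, rfl⟩ := codes_rat_iff.1 hv
  refine ⟨x, hx, hfx, x.2.lt_size_self.le.trans (Nat.pow_le_pow_right two_pos ?_)⟩
  simp [length_pairStr, Nat.size_eq_bits_len] at hvq
  omega

/-- A function that is computable in polynomial time on codes can be evaluated whenever one can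
test a condition that makes sure that its argument is a code. -/
theorem PolyTime.exists_eval {α β : Type} [Coding α] [Coding β] {f : α → β} (hf : PolyTime f)
    {k : ℕ} {γ : Type} [Enc γ] {c : γ → Bool} {g : γ → Str} (hc : FP k c) (hg : FP k g)
    (hcg : ∀ t, c t = true → ∃ a : α, Coding.Codes (g t) a) :
    ∃ F : γ → Str, FP k F ∧ ∀ t a, c t = true → Coding.Codes (g t) a →
      Coding.Codes (F t) (f a) := by
  obtain ⟨p, q, h⟩ := hf
  -- The final store is to depend on the string alone, so the element is quantified inside; this is
  -- consistent because a string codes at most one element.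
  have h' : ∀ u : {u : Str // ∃ a : α, Coding.Codes u a}, ∃ (τ : Store) (n : ℕ),
      Exec noOracle p (initStore u.1) τ n ∧ n ≤ q.eval u.1.length ∧
      ∀ a, Coding.Codes u.1 a → Coding.Codes (τ 0) (f a) := by
    rintro ⟨u, a, ha⟩
    obtain ⟨τ, n, h1, h2, h3⟩ := h a u ha
    exact ⟨τ, n, h1, h2, fun a' ha' => Coding.code_unique ha ha' ▸ h3⟩
  choose τ n h1 h2 h3 using h'
  have hF : FP k fun u => τ u 0 := FP.of_noOracle
    ⟨.seq p (.clearUpTo p.bound), q + (2 + (p.bound : Polynomial ℕ) * (2 * q + 1)),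
      fun u => (exec_clean ⟨n u, h2 u, h1 u⟩).mono (by simp)⟩
  have hval : FP k fun t : {t : γ // c t = true} => t.1 :=
    FP.of_polyFun fun _ => .of_enc_eq fun _ => rfl
  have hD : FP k fun t : {t : γ // c t = true} =>
      (⟨g t.1, hcg t.1 t.2⟩ : {u : Str // ∃ a : α, Coding.Codes u a}) := .of_enc (hg.comp hval)
  -- The program is run only behind the guard, as nothing is known about it on strings that are not
  -- codes.
  refine ⟨fun t => if ht : c t = true then τ ⟨g t, hcg t ht⟩ 0 else [],
    .ite_subtype (f := fun t => τ ⟨g t.1, hcg t.1 t.2⟩ 0) (g := fun _ => []) hc (hF.comp hD)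
      (.const _) (fun t => by simp [t.2]) (fun t => by simp [t.2]), fun t a ht ha => ?_⟩
  simp only [dif_pos ht]
  exact h3 _ a ha

/-! ### Codes of lists -/

/-- Do the first `i` members of two lists have the same codes? -/
def agreeStr : ℕ → Str → Str → Bool
  | 0, _, _ => true
  | i + 1, u, u' => decide ((unpairStr u).1 = (unpairStr u').1) &&
      agreeStr i (unpairStr u).2 (unpairStr u').2

@[fun_prop]
theorem FP.agreeStr {k : ℕ} {α : Type} [Enc α] (i : ℕ) {f g : α → Str} (hf : FP k f)
    (hg : FP k g) : FP k fun a => agreeStr i (f a) (g a) := by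
  induction i generalizing f g with
  | zero => exact .const true
  | succ i ih =>
      have := ih hf.unpairStr.snd hg.unpairStr.snd
      unfold _root_.agreeStr
      fun_prop

section

variable {α : Type} [Coding α]

/-- Equal codes imply equal members. The converse fails, since a rational number has many codes;
certificates have to be chosen accordingly. -/
theorem take_eq_of_agreeStr {i : ℕ} {u u' : Str} {l l' : List α} (h : CodesList u l)
    (h' : CodesList u' l') (hl : l.length = l'.length) (hi : agreeStr i u u' = true) :
    l.take i = l'.take i := by
  induction i generalizing u u' l l' with
  | zero => simp
  | succ i ih =>
      rcases l with _ | ⟨a, l⟩ <;> rcases l' with _ | ⟨a', l'⟩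
      · rfl
      · simp at hl
      · simp at hl
      · obtain ⟨v, x, hv, hx, rfl⟩ := h
        obtain ⟨v', x', hv', hx', rfl⟩ := h'
        simp only [agreeStr, unpairStr_pairStr, Bool.and_eq_true, decide_eq_true_eq] at hi
        obtain ⟨rfl, hi⟩ := hi
        rw [List.take_succ_cons, List.take_succ_cons, Coding.code_unique hv hv',
          ih hx hx' (by simpa using hl) hi]

theorem exists_codesList_length_le {l : List α} {M : ℕ}
    (hM : ∀ a ∈ l, ∃ u, Coding.Codes u a ∧ u.length ≤ M) :
    ∃ u, CodesList u l ∧ u.length ≤ l.length * (2 * M + 1) := by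
  induction l with
  | nil => exact ⟨[], rfl, by simp⟩
  | cons a l ih =>
      obtain ⟨u, hu, huM⟩ := hM a (by simp)
      obtain ⟨v, hv, hvM⟩ := ih fun b hb => hM b (by simp [hb])
      refine ⟨_, ⟨u, v, hu, hv, rfl⟩, ?_⟩
      rw [length_pairStr, List.length_cons, add_mul]
      omega

/-- The new code copies the codes of the first `i` members from `u`, however wasteful they may be,
and uses short codes for the others. The comparison of strings then succeeds, and the length remains
controlled by that of `u`. -/
theorem exists_codesList_agreeStr {i : ℕ} {u : Str} {l l' : List α} {M : ℕ} (h : CodesList u l)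
    (hl : l.length = l'.length) (hi : l.take i = l'.take i)
    (hM : ∀ a ∈ l'.drop i, ∃ u, Coding.Codes u a ∧ u.length ≤ M) :
    ∃ u', CodesList u' l' ∧ agreeStr i u u' = true ∧
      u'.length ≤ u.length + l'.length * (2 * M + 1) := by
  induction i generalizing u l l' with
  | zero =>
      obtain ⟨u', h1, h2⟩ := exists_codesList_length_le (by simpa using hM)
      exact ⟨u', h1, rfl, by omega⟩
  | succ i ih =>
      rcases l with _ | ⟨a, l⟩ <;> rcases l' with _ | ⟨a', l'⟩
      · refine ⟨u, h, ?_, by simp⟩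
        have : ∀ (i : ℕ) (u : Str), agreeStr i u u = true := by
          intro i
          induction i with
          | zero => simp [agreeStr]
          | succ i ih => simp [agreeStr, ih]
        exact this _ _
      · simp at hl
      · simp at hl
      · obtain ⟨v, x, hv, hx, rfl⟩ := h
        simp only [List.take_succ_cons, List.cons.injEq] at hi
        obtain ⟨rfl, hi⟩ := hi
        obtain ⟨u', h1, h2, h3⟩ := ih hx (by simpa using hl) hi (by simpa using hM)
        refine ⟨pairStr v u', ⟨v, u', hv, h1, rfl⟩, by simp [agreeStr, h2], ?_⟩
        rw [length_pairStr, length_pairStr, List.length_cons, add_mul]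
        omega

end

/-- From the code of a rational vector compute the code of the zero vector of the same length. -/
def zerosStr (u : Str) : Str :=
  (u.foldl (fun s _ => bif s.1.isEmpty then s
    else ((unpairStr s.1).2, pairStr (enc ((0, 1) : ℤ × ℕ)) s.2)) (u, ([] : Str))).2

@[fun_prop]
theorem FP.zerosStr {k : ℕ} {α : Type} [Enc α] {f : α → Str} (hf : FP k f) :
    FP k fun a => zerosStr (f a) := by
  refine FP.snd (foldl_of_le (step := fun _ s _ => bif s.1.isEmpty then s
    else ((_root_.unpairStr s.1).2, _root_.pairStr (Enc.enc ((0, 1) : ℤ × ℕ)) s.2))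
    hf (by fun_prop) (by fun_prop) (2 * (Enc.enc ((0, 1) : ℤ × ℕ)).length + 1) fun a s b => ?_)
  have := length_unpairStr s.1
  cases h : s.1.isEmpty
  · simp only [cond_false, enc_prod s, enc_prod (_, _), enc_str, length_pairStr]
    omega
  · simp

/-- One member is removed per round and each takes up at least one bit of the code, so as many
rounds as `u` has bits are enough. -/
theorem codesList_zerosStr {u : Str} {v : Vec} (h : CodesList u v) :
    CodesList (zerosStr u) (List.replicate v.length (0 : ℚ)) := by
  have key : ∀ (l : Str) (v : Vec) (u acc : Str) (n : ℕ), CodesList u v → v.length ≤ l.length →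
      CodesList acc (List.replicate n (0 : ℚ)) →
      CodesList (l.foldl (fun s _ => bif s.1.isEmpty then s
        else ((unpairStr s.1).2, pairStr (enc ((0, 1) : ℤ × ℕ)) s.2)) (u, acc)).2
        (List.replicate (v.length + n) (0 : ℚ)) := by
    intro l
    induction l with
    | nil =>
        intro v u acc n hu hv hacc
        have : v = [] := by simpa using hv
        subst this
        simpa using hacc
    | cons x l ih =>
        intro v u acc n hu hv hacc
        rcases v with _ | ⟨a, v⟩
        · have : u = [] := hu
          subst this
          exact ih [] [] acc n rfl (by simp) hacc
        · obtain ⟨u₁, u₂, h1, h2, rfl⟩ := hu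
          have hne : (pairStr u₁ u₂).isEmpty = false := by simp [pairStr_ne_nil]
          rw [List.foldl_cons]
          simp only [hne, cond_false, unpairStr_pairStr]
          rw [List.length_cons, add_assoc, add_comm 1 n]
          exact ih v u₂ _ (n + 1) h2 (by simpa using hv)
            ⟨_, _, codes_rat_iff.2 ⟨(0, 1), by simp, by simp [fracVal], rfl⟩, hacc, rfl⟩
  have hlen : ∀ (v : Vec) (u : Str), CodesList u v → v.length ≤ u.length := by
    intro v
    induction v with
    | nil => simp
    | cons a v ih =>
        rintro u ⟨u₁, u₂, h1, h2, rfl⟩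
        have := ih _ h2
        rw [length_pairStr, List.length_cons]
        omega
  exact key u v u [] 0 h (hlen v u h) rfl

/-! ## Multilevel problems -/

/-- The code of a joint decision of an instance, given codes of its parts. -/
def jointStr (t : Str × Str × Str) : Str := pairStr (pairStr t.1 t.2.1) t.2.2

@[fun_prop]
theorem FP.jointStr {k : ℕ} {α : Type} [Enc α] {f : α → Str × Str × Str} (hf : FP k f) :
    FP k fun a => jointStr (f a) := by
  unfold _root_.jointStr
  fun_prop

/-- Joint decisions, together with the instance and separated into the decisions of the upper
levels and of the bottom level. -/
abbrev Joint (s : ℕ) : Type := (Str × (Fin s → Vec)) × Vec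

variable {s : ℕ}

/-! ### Deciding sets of joint decisions on codes -/

theorem jointStr_mem_iff {S : Set (Joint s)} {t : Str × Str × Str} :
    jointStr t ∈ codeLanguage S ↔ ∃ x v, Coding.Codes t.2.1 x ∧ Coding.Codes t.2.2 v ∧
      ((t.1, x), v) ∈ S := by
  constructor
  · rintro ⟨⟨⟨w, x⟩, v⟩, hS, u₁, uv, ⟨uw, ux, hw, hx, rfl⟩, hv, h⟩
    obtain ⟨h1, rfl⟩ := pairStr_inj h
    obtain ⟨rfl, rfl⟩ := pairStr_inj h1
    cases (show t.1 = w from hw)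
    exact ⟨x, v, hx, hv, hS⟩
  · rintro ⟨x, v, hx, hv, hS⟩
    exact ⟨_, hS, _, _, ⟨_, _, rfl, hx, rfl⟩, hv, rfl⟩

theorem jointStr_mem_iff_of_codes {S : Set (Joint s)} {w ux uv : Str} {x : Fin s → Vec} {v : Vec}
    (hx : Coding.Codes ux x) (hv : Coding.Codes uv v) :
    jointStr (w, ux, uv) ∈ codeLanguage S ↔ ((w, x), v) ∈ S := by
  rw [jointStr_mem_iff]
  constructor
  · rintro ⟨x', v', hx', hv', h⟩
    rwa [Coding.code_unique hx hx', Coding.code_unique hv hv']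
  · exact fun h => ⟨x, v, hx, hv, h⟩

/-- The characteristic function of a set of joint decisions, on codes. -/
noncomputable def jointChar (S : Set (Joint s)) (t : Str × Str × Str) : Bool :=
  charFun (codeLanguage S) (jointStr t)

theorem jointChar_eq_true {S : Set (Joint s)} {t : Str × Str × Str} :
    jointChar S t = true ↔ ∃ x v, Coding.Codes t.2.1 x ∧ Coding.Codes t.2.2 v ∧
      ((t.1, x), v) ∈ S := by
  rw [jointChar, charFun_eq_true, jointStr_mem_iff]

theorem jointChar_iff_of_codes {S : Set (Joint s)} {w ux uv : Str} {x : Fin s → Vec} {v : Vec}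
    (hx : Coding.Codes ux x) (hv : Coding.Codes uv v) :
    jointChar S (w, ux, uv) = true ↔ ((w, x), v) ∈ S := by
  rw [jointChar, charFun_eq_true, jointStr_mem_iff_of_codes hx hv]

/-- To decide a subset of a decidable set it suffices to consider codes of members of the latter. -/
theorem FP.jointChar_of_subset {k : ℕ} {S S₀ : Set (Joint s)} {c : Str × Str × Str → Bool}
    (h₀ : FP k (jointChar S₀)) (hc : FP k c) (hS : S ⊆ S₀)
    (h : ∀ w ux uv x v, Coding.Codes ux x → Coding.Codes uv v → ((w, x), v) ∈ S₀ →
      (c (w, ux, uv) = true ↔ ((w, x), v) ∈ S)) : FP k (jointChar S) := by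
  have : FP k fun t => jointChar S₀ t && c t := by fun_prop
  convert this using 2 with t
  rw [Bool.eq_iff_iff, Bool.and_eq_true, jointChar_eq_true, jointChar_eq_true]
  constructor
  · rintro ⟨x, v, hx, hv, hS'⟩
    exact ⟨⟨x, v, hx, hv, hS hS'⟩, (h _ _ _ _ _ hx hv (hS hS')).2 hS'⟩
  · rintro ⟨⟨x, v, hx, hv, hS'⟩, hct⟩
    exact ⟨x, v, hx, hv, (h _ _ _ _ _ hx hv hS').1 hct⟩

namespace MultilevelProblem

variable (P : MultilevelProblem s)

/-- The joint decisions that are feasible for the domains of all levels. -/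
def jointFeasible : Set (Joint s) := {p | p.1 ∈ P.bottom.valid ∧ p.2 ∈ P.Y p.1.1 p.1.2}

/-- The joint decisions that satisfy the constraints of the `i`-th upper level. -/
def jointConstraints (U : Str → (Fin s → Vec) × Vec → Set Vec) (i : Fin s) : Set (Joint s) :=
  {p | p ∈ P.jointFeasible ∧
    ∀ k < P.m i p.1.1, ∀ z ∈ U p.1.1 (p.1.2, p.2), P.G i p.1.1 k p.1.2 z ≤ 0}

/-- The joint decisions in which the levels from `i` on react optimally. -/
def jointResponse (U : Str → (Fin s → Vec) × Vec → Set Vec) (i : ℕ) : Set (Joint s) :=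
  {p | p ∈ P.jointFeasible ∧ (p.1.2, p.2) ∈ P.response (U p.1.1) p.1.1 i}

variable {P} {r : ℕ}

theorem BottomVerifiable.fp (hY : P.BottomVerifiable r) : FP r (jointChar P.jointFeasible) := by
  have h := mem_pWithSigmaOracle_iff.1 hY
  exact h.comp (FP.jointStr FP.id)

/-! ### Evaluation of the data -/

/-- Recognizing codes of joint decisions is itself available through the feasibility test, which
therefore serves as the guard for the evaluation. -/
theorem BottomVerifiable.exists_eval_rat (hY : P.BottomVerifiable r)
    {φ : Str → (Fin s → Vec) → Vec → ℚ}
    (hφ : PolyTime fun p : Str × (Fin s → Vec) × Vec => φ p.1 p.2.1 p.2.2) :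
    ∃ E : Str × Str × Str → ℤ × ℕ, FP r E ∧ ∀ w ux uv x v, Coding.Codes ux x →
      Coding.Codes uv v → ((w, x), v) ∈ P.jointFeasible →
      0 < (E (w, ux, uv)).2 ∧ φ w x v = fracVal (E (w, ux, uv)) := by
  obtain ⟨F, hF, h⟩ := hφ.exists_eval hY.fp (g := fun t => pairStr t.1 (pairStr t.2.1 t.2.2))
    (by fun_prop) (by
      intro t ht
      obtain ⟨x, v, hx, hv, -⟩ := jointChar_eq_true.1 ht
      exact ⟨(t.1, x, v), _, _, rfl, ⟨_, _, hx, hv, rfl⟩, rfl⟩)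
  refine ⟨fun t => parseFrac (F t), by fun_prop, fun w ux uv x v hx hv hS => ?_⟩
  have := h (w, ux, uv) (w, x, v) ((jointChar_iff_of_codes hx hv).2 hS)
    ⟨_, _, rfl, ⟨_, _, hx, hv, rfl⟩, rfl⟩
  exact (codes_rat_iff_parseFrac.1 this).2

theorem codes_ones (n : ℕ) : Coding.Codes (ones (List.replicate n true)) n := by
  simp [ones, Coding.Codes]

theorem BottomVerifiable.exists_eval_rat_index (hY : P.BottomVerifiable r)
    {φ : Str → ℕ → (Fin s → Vec) → Vec → ℚ}
    (hφ : PolyTime fun p : Str × ℕ × (Fin s → Vec) × Vec => φ p.1 p.2.1 p.2.2.1 p.2.2.2) :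
    ∃ E : Str × Str × Str × Str → ℤ × ℕ, FP r E ∧ ∀ k w ux uv x v, Coding.Codes ux x →
      Coding.Codes uv v → ((w, x), v) ∈ P.jointFeasible →
      0 < (E (List.replicate k true, w, ux, uv)).2 ∧
        φ w k x v = fracVal (E (List.replicate k true, w, ux, uv)) := by
  have hgood := hY.fp
  -- By `ones` every index string becomes a code of its length, so the guard need only concern the
  -- joint decision.
  obtain ⟨F, hF, h⟩ := hφ.exists_eval (k := r) (c := fun t => jointChar P.jointFeasible t.2)
    (g := fun t : Str × Str × Str × Str =>
      pairStr t.2.1 (pairStr (ones t.1) (pairStr t.2.2.1 t.2.2.2))) (by fun_prop)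
    (by fun_prop) (by
      intro t ht
      obtain ⟨x, v, hx, hv, -⟩ := jointChar_eq_true.1 ht
      exact ⟨(t.2.1, t.1.length, x, v), _, _, rfl, ⟨_, _, rfl, ⟨_, _, hx, hv, rfl⟩, rfl⟩, rfl⟩)
  refine ⟨fun t => parseFrac (F t), by fun_prop, fun k w ux uv x v hx hv hS => ?_⟩
  have := h (List.replicate k true, w, ux, uv) (w, k, x, v)
    ((jointChar_iff_of_codes hx hv).2 hS)
    ⟨_, _, rfl, ⟨_, _, codes_ones k, ⟨_, _, hx, hv, rfl⟩, rfl⟩, rfl⟩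
  exact (codes_rat_iff_parseFrac.1 this).2

theorem BottomVerifiable.exists_eval_index (hY : P.BottomVerifiable r) {κ : Type} [Coding κ]
    {e : Str × ℕ × (Fin s → Vec) → κ} (he : PolyTime e) :
    ∃ E : Str × Str × Str × Str → Str, FP r E ∧ ∀ k w ux uv x v, Coding.Codes ux x →
      Coding.Codes uv v → ((w, x), v) ∈ P.jointFeasible →
      Coding.Codes (E (List.replicate k true, w, ux, uv)) (e (w, k, x)) := by
  have hgood := hY.fp
  obtain ⟨F, hF, h⟩ := he.exists_eval (k := r) (c := fun t => jointChar P.jointFeasible t.2)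
    (g := fun t : Str × Str × Str × Str => pairStr t.2.1 (pairStr (ones t.1) t.2.2.1))
    (by fun_prop) (by fun_prop) (by
      intro t ht
      obtain ⟨x, v, hx, hv, -⟩ := jointChar_eq_true.1 ht
      exact ⟨(t.2.1, t.1.length, x), _, _, rfl, ⟨_, _, rfl, hx, rfl⟩, rfl⟩)
  exact ⟨F, hF, fun k w ux uv x v hx hv hS => h (List.replicate k true, w, ux, uv) (w, k, x)
    ((jointChar_iff_of_codes hx hv).2 hS) ⟨_, _, rfl, ⟨_, _, codes_ones k, hx, rfl⟩, rfl⟩⟩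

theorem _root_.PolyTime.exists_eval_str {β : Type} [Coding β] {f : Str → β} (hf : PolyTime f)
    (k : ℕ) : ∃ F : Str → Str, FP k F ∧ ∀ w, Coding.Codes (F w) (f w) := by
  obtain ⟨F, hF, h⟩ := hf.exists_eval (k := k) (c := fun _ => true) (g := fun w : Str => w)
    (.const _) .id fun w _ => ⟨w, rfl⟩
  exact ⟨F, hF, fun w => h w w rfl rfl⟩

/-- A bound on the denominators of the values of objective functions. -/
theorem PolyTimeData.exists_bound (hP : P.PolyTimeData) {φ : Str → (Fin s → Vec) → Vec → ℚ}
    (hφ : PolyTime fun p : Str × (Fin s → Vec) × Vec => φ p.1 p.2.1 p.2.2) :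
    ∃ q : Polynomial ℕ, ∀ w ux x y, Coding.Codes ux x → ((w, x), y) ∈ P.jointFeasible →
      ∃ z : ℤ × ℕ, 0 < z.2 ∧ φ w x y = fracVal z ∧ z.2 ≤ 2 ^ q.eval (w ++ ux).length := by
  obtain ⟨q, h⟩ := hφ.exists_fracVal_eq
  obtain ⟨b, hb⟩ := hP.size_Y
  refine ⟨q.comp (2 * .X + b + 2), fun w ux x y hx hy => ?_⟩
  obtain ⟨uy, huy, hlen⟩ := hb _ hy.1 y hy.2
  obtain ⟨z, h1, h2, h3⟩ := h (w, x, y) _ ⟨_, _, rfl, ⟨_, _, hx, huy, rfl⟩, rfl⟩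
  refine ⟨z, h1, h2, h3.trans (Nat.pow_le_pow_right two_pos ?_)⟩
  rw [Polynomial.eval_comp]
  refine polynomial_eval_mono q ?_
  have : b.eval w.length ≤ b.eval (w ++ ux).length := polynomial_eval_mono b (by simp)
  simp [length_pairStr] at hlen this ⊢
  omega

/-- A bound on the denominators of the values of the constraint functions. -/
theorem PolyTimeData.exists_bound_index (hP : P.PolyTimeData)
    {φ : Str → ℕ → (Fin s → Vec) → Vec → ℚ}
    (hφ : PolyTime fun p : Str × ℕ × (Fin s → Vec) × Vec => φ p.1 p.2.1 p.2.2.1 p.2.2.2) :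
    ∃ q : Polynomial ℕ, ∀ k w ux x y, Coding.Codes ux x → ((w, x), y) ∈ P.jointFeasible →
      ∃ z : ℤ × ℕ, 0 < z.2 ∧ φ w k x y = fracVal z ∧
        z.2 ≤ 2 ^ q.eval (w ++ ux ++ List.replicate k true).length := by
  obtain ⟨q, h⟩ := hφ.exists_fracVal_eq
  obtain ⟨b, hb⟩ := hP.size_Y
  refine ⟨q.comp (2 * .X + b + 3), fun k w ux x y hx hy => ?_⟩
  obtain ⟨uy, huy, hlen⟩ := hb _ hy.1 y hy.2
  obtain ⟨z, h1, h2, h3⟩ := h (w, k, x, y) _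
    ⟨_, _, rfl, ⟨_, _, rfl, ⟨_, _, hx, huy, rfl⟩, rfl⟩, rfl⟩
  refine ⟨z, h1, h2, h3.trans (Nat.pow_le_pow_right two_pos ?_)⟩
  rw [Polynomial.eval_comp]
  refine polynomial_eval_mono q ?_
  have : b.eval w.length ≤ b.eval (w ++ ux ++ List.replicate k true).length :=
    polynomial_eval_mono b (by simp)
  simp [length_pairStr] at hlen this ⊢
  omega

theorem _root_.FP.two_pow_polynomial {k : ℕ} {α : Type} [Enc α] (q : Polynomial ℕ) {f : α → Str}
    (hf : FP k f) : FP k fun a => 2 ^ q.eval (f a).length := by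
  simpa using FP.two_pow (FP.polynomial_length q hf)

/-! ### The bottom level -/

/-- Optimality for the bottom level can be verified with an oracle for its decision problem. -/
theorem fp_jointResponse_bottom (hP : P.PolyTimeData) (hY : P.BottomVerifiable r)
    (hL : P.bottom.InSigma r) (U : Str → (Fin s → Vec) × Vec → Set Vec) :
    FP r (jointChar (P.jointResponse U s)) := by
  obtain ⟨E, hE, hEf⟩ := hY.exists_eval_rat hP.polyTime_f
  obtain ⟨q, hq⟩ := hP.exists_bound hP.polyTime_f
  have hdec := SigmaP.charFun hL
  have hD : FP r fun t : Str × Str × Str => 2 ^ q.eval (t.1 ++ t.2.1).length :=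
    FP.two_pow_polynomial q (by fun_prop)
  -- The bound in the query is the value of `v`, lowered so little that only strictly better
  -- solutions can meet it; `v` is optimal iff the answer is negative.
  refine FP.jointChar_of_subset hY.fp (c := fun t => !charFun (codeLanguage P.bottom.decision)
    (pairStr (pairStr t.1 t.2.1) (enc (fracPred (E t) (2 ^ q.eval (t.1 ++ t.2.1).length)))))
    (by fun_prop) (fun p hp => hp.1) fun w ux uv x v hx hv hS => ?_
  obtain ⟨hpos, hval⟩ := hEf w ux uv x v hx hv hS
  have hresp : P.response (U w) w s = P.bottomOptimal w := by rw [response]; simp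
  have hcode : pairStr (pairStr w ux) (enc (fracPred (E (w, ux, uv))
      (2 ^ q.eval (w ++ ux).length))) ∈ codeLanguage P.bottom.decision ↔
      ∃ y ∈ P.Y w x, P.f w x y < P.f w x v := by
    have hcodes : Coding.Codes (pairStr (pairStr w ux) (enc (fracPred (E (w, ux, uv))
        (2 ^ q.eval (w ++ ux).length)))) ((w, x), fracVal (fracPred (E (w, ux, uv))
        (2 ^ q.eval (w ++ ux).length))) :=
      ⟨_, _, ⟨_, _, rfl, hx, rfl⟩, codes_fracVal (fracPred_snd_pos hpos (by positivity)), rfl⟩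
    trans ((w, x), fracVal (fracPred (E (w, ux, uv)) (2 ^ q.eval (w ++ ux).length))) ∈
      P.bottom.decision
    · exact ⟨fun ⟨a, ha, hc⟩ => Coding.code_unique hcodes hc ▸ ha, fun h => ⟨_, h, hcodes⟩⟩
    · refine (and_iff_right hS.1).trans (exists_congr fun y => and_congr_right fun hy => ?_)
      obtain ⟨z, hz, hzy, hzD⟩ := hq w ux x y hx ⟨hS.1, hy⟩
      change P.f w x y ≤ _ ↔ _
      rw [hzy, hval, le_fracVal_fracPred_iff hz hpos hzD]
  simp only [Bool.not_eq_true', charFun_eq_false, hcode]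
  simp only [jointResponse, Set.mem_ofPred_eq, hresp, bottomOptimal, hS, true_and, hS.2]
  push Not
  rfl

/-! ### Constraints -/

theorem fp_jointConstraints_canonical (hP : P.PolyTimeData) (hY : P.BottomVerifiable r)
    (i : Fin s) : FP r (jointChar (P.jointConstraints (fun _ p => {p.2}) i)) := by
  obtain ⟨E, hE, hEG⟩ := hY.exists_eval_rat_index (hP.polyTime_G i)
  obtain ⟨M, hM, hMm⟩ := (hP.polyTime_m i).exists_eval_str r
  refine FP.jointChar_of_subset hY.fp
    (FP.forall_lt (l := fun t : Str × Str × Str => M t.1)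
      (c := fun t => !fracLt ((0, 1) : ℤ × ℕ) (E t)) (by fun_prop) (by fun_prop))
    (fun p hp => hp.1) fun w ux uv x v hx hv hS => ?_
  have hlen : (M w).length = P.m i w := by
    rw [show M w = List.replicate (P.m i w) true from hMm w, List.length_replicate]
  simp only [decide_eq_true_eq, hlen, jointConstraints, Set.mem_ofPred_eq, hS, true_and,
    Set.mem_singleton_iff, forall_eq]
  refine forall₂_congr fun k hk => ?_
  obtain ⟨hpos, hval⟩ := hEG k w ux uv x v hx hv hS
  rw [Bool.not_eq_true', ← Bool.not_eq_true, fracLt_iff (by simp) hpos, ← hval]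
  simp [fracVal]

/-- The universal quantifier over near-optimal decisions is the negation of one query per
constraint: can `-G` be made negative on the part of the epigraph where `u ≤ f(x, v) + δ`? There are
polynomially many constraints, as their number is computed in unary. -/
theorem fp_jointConstraints_nearOptimal (hP : P.PolyTimeData) (hY : P.BottomVerifiable r)
    {κ : Type} [Coding κ] {H : κ → Vec → ℚ} (hG : P.NegConstraintsIn H)
    (hL : (P.bottom.modified H).InSigma r) (i : Fin s) :
    FP r (jointChar (P.jointConstraints (fun w p => insert p.2 (P.nearOptimal w p)) i)) := by
  obtain ⟨e, he, heG⟩ := hG i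
  obtain ⟨E, hE, hEf⟩ := hY.exists_eval_rat hP.polyTime_f
  obtain ⟨D, hD, hDδ⟩ := hP.polyTime_δ.exists_eval_str r
  obtain ⟨M, hM, hMm⟩ := (hP.polyTime_m i).exists_eval_str r
  obtain ⟨K, hK, hKe⟩ := hY.exists_eval_index he
  obtain ⟨q, hq⟩ := hP.exists_bound_index (hP.polyTime_G i)
  have hdec := SigmaP.charFun hL
  have hpow : FP r fun t : Str × Str × Str × Str => 2 ^ q.eval (t.2.1 ++ t.2.2.1 ++ t.1).length :=
    FP.two_pow_polynomial q (by fun_prop)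
  -- The query: coefficients `0` for `y` and `1` for `u`, right-hand side `f(x, v) + δ`, the index
  -- of `-G`, and a bound just below zero.
  let c : Str × Str × Str × Str → Str := fun t =>
    pairStr (pairStr (pairStr t.2.1 t.2.2.1)
      (pairStr (pairStr (zerosStr t.2.2.2) (pairStr (enc ((1, 1) : ℤ × ℕ))
        (enc (fracAdd (E t.2) (parseFrac (D t.2.1)))))) (K t)))
      (enc (fracPred (0, 1) (2 ^ q.eval (t.2.1 ++ t.2.2.1 ++ t.1).length)))
  have hc : FP r c := by fun_prop
  refine FP.jointChar_of_subset hY.fp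
    (FP.forall_lt (l := fun t : Str × Str × Str => M t.1)
      (c := fun t => !charFun (codeLanguage (P.bottom.modified H).decision) (c t))
      (by fun_prop) (by fun_prop))
    (fun p hp => hp.1) fun w ux uv x v hx hv hS => ?_
  have hlen : (M w).length = P.m i w := by
    rw [show M w = List.replicate (P.m i w) true from hMm w, List.length_replicate]
  -- As `δ` is nonnegative, the canonical decision is itself near-optimal.
  have hins : insert v (P.nearOptimal w (x, v)) = P.nearOptimal w (x, v) :=
    Set.insert_eq_of_mem ⟨hS.2, le_add_of_nonneg_right (P.δ_nonneg w)⟩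
  simp only [decide_eq_true_eq, hlen, jointConstraints, Set.mem_ofPred_eq, hS, true_and, hins]
  refine forall₂_congr fun k hk => ?_
  obtain ⟨hpos, hval⟩ := hEf w ux uv x v hx hv hS
  obtain ⟨-, hδpos, hδ⟩ := codes_rat_iff_parseFrac.1 (hDδ w)
  have hcodes : Coding.Codes (c (List.replicate k true, w, ux, uv))
      (((w, x), (List.replicate v.length (0 : ℚ), (1 : ℚ), P.f w x v + P.δ w), e (w, k, x)),
        fracVal (fracPred (0, 1) (2 ^ q.eval (w ++ ux ++ List.replicate k true).length))) := by
    refine ⟨_, _, ⟨_, _, ⟨_, _, rfl, hx, rfl⟩, ⟨_, _, ⟨_, _, codesList_zerosStr hv,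
      ⟨_, _, codes_rat_iff.2 ⟨(1, 1), by simp, by simp [fracVal], rfl⟩,
        codes_rat_iff.2 ⟨_, fracAdd_snd_pos hpos hδpos, ?_, rfl⟩, rfl⟩, rfl⟩,
        hKe k w ux uv x v hx hv hS, rfl⟩, rfl⟩,
      codes_fracVal (fracPred_snd_pos (by simp) (by positivity)), rfl⟩
    rw [fracVal_fracAdd hpos hδpos, ← hval, ← hδ]
  have hmem : c (List.replicate k true, w, ux, uv) ∈
      codeLanguage (P.bottom.modified H).decision ↔
      ∃ y ∈ P.nearOptimal w (x, v), 0 < P.G i w k x y := by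
    refine Iff.trans ⟨fun ⟨a, ha, hc⟩ => Coding.code_unique hcodes hc ▸ ha,
      fun h => ⟨_, h, hcodes⟩⟩ ?_
    have hsum : ∀ (n : ℕ) (y : Vec),
        (List.zipWith (· * ·) (List.replicate n (0 : ℚ)) y).sum = 0 := by
      intro n
      induction n with
      | zero => simp
      | succ n ih => intro y; cases y <;> simp [List.replicate_succ, ih]
    obtain ⟨n, hn⟩ := hP.dim_Y
    have hobj : ∀ y ∈ P.Y w x, (H (e (w, k, x)) y ≤ fracVal (fracPred (0, 1)
        (2 ^ q.eval (w ++ ux ++ List.replicate k true).length)) ↔ 0 < P.G i w k x y) := by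
      intro y hy
      obtain ⟨z, hz, hzy, hzD⟩ := hq k w ux x y hx ⟨hS.1, hy⟩
      have hneg : - P.G i w k x y = fracVal (-z.1, z.2) := by
        rw [hzy]; simp [fracVal, neg_div]
      rw [heG w k x hS.1 hk y hy, hneg, le_fracVal_fracPred_iff (p := (-z.1, z.2)) hz (by simp) hzD,
        ← hneg]
      simp [fracVal]
    constructor
    · rintro ⟨-, ⟨y, u⟩, ⟨hy, hyu, -, hle⟩, hobj'⟩
      refine ⟨y, ⟨hy, ?_⟩, (hobj y hy).1 hobj'⟩
      simp only [hsum, zero_add, one_mul] at hle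
      exact le_trans hyu hle
    -- The least admissible `u`, the value of `y`, works. The zero vector has the length of `v`, and
    -- all feasible bottom-level decisions share this dimension.
    · rintro ⟨y, ⟨hy, hle⟩, hpos'⟩
      refine ⟨hS.1, (y, P.f w x y), ⟨hy, le_rfl, ?_, ?_⟩, (hobj y hy).2 hpos'⟩
      · simp only [List.length_replicate]
        rw [hn _ hS.1 v hS.2, hn _ hS.1 y hy]
      · simpa only [hsum, zero_add, one_mul] using hle
  rw [Bool.not_eq_true', charFun_eq_false, hmem]
  push Not
  rfl

/-! ### Upper levels -/

theorem response_of_lt (U : (Fin s → Vec) × Vec → Set Vec) (w : Str) (i : Fin s) :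
    P.response U w i = P.levelOptimal U w i (P.response U w (i + 1)) := by
  rw [response, dif_pos i.2]

/-- Feasibility at a level contains the response of the next one, so the domain conditions
accumulate. Those above level `i` are not included: the decisions there are mere parameters. -/
theorem response_subset (U : (Fin s → Vec) × Vec → Set Vec) (w : Str) {i : ℕ} (hi : i ≤ s) :
    ∀ p ∈ P.response U w i, p.2 ∈ P.Y w p.1 ∧ ∀ j : Fin s, i ≤ j → p.1 j ∈ P.X j w := by
  induction hi using Nat.decreasingInduction with
  | self =>
      intro p hp
      rw [response, dif_neg (lt_irrefl s)] at hp
      exact ⟨hp.1, fun j hj => absurd j.2 (by omega)⟩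
  | of_succ i hi ih =>
      intro p hp
      rw [response_of_lt U w ⟨i, hi⟩] at hp
      obtain ⟨⟨h1, -, h2⟩, -⟩ := hp
      refine ⟨(ih p h2).1, fun j hj => ?_⟩
      rcases hj.eq_or_lt with h | h
      · have : j = ⟨i, hi⟩ := Fin.ext h.symm
        rwa [this]
      · exact (ih p h2).2 j h

/-- The joint decisions that are feasible for the `i`-th upper level and all levels below have
codes of polynomial length. -/
theorem PolyTimeData.exists_codes (hP : P.PolyTimeData) : ∃ q : Polynomial ℕ,
    ∀ (w : Str) (i : ℕ) (ux : Str) (x x' : Fin s → Vec) (v' : Vec), Coding.Codes ux x →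
      (∀ j : Fin s, (j : ℕ) < i → x' j = x j) → ((w, x'), v') ∈ P.jointFeasible →
      ∃ ux' uv', Coding.Codes ux' x' ∧ Coding.Codes uv' v' ∧ agreeStr i ux ux' = true ∧
        (pairStr ux' uv').length ≤ q.eval (w ++ ux).length := by
  obtain ⟨qX, hqX⟩ := hP.size_X
  obtain ⟨qY, hqY⟩ := hP.size_Y
  refine ⟨2 * (.X + (s : Polynomial ℕ) * (2 * qX + 1)) + qY + 1,
    fun w i ux x x' v' hx hagree hS => ?_⟩
  obtain ⟨ux', h1, h2, h3⟩ := exists_codesList_agreeStr (i := i) (l' := List.ofFn x')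
    (M := qX.eval w.length) hx (by simp) (by
      refine List.ext_getElem (by simp) fun j hj hj' => ?_
      simp at hj
      simpa using (hagree ⟨j, hj.2⟩ hj.1).symm) (fun a ha => by
      obtain ⟨j, rfl⟩ := (List.mem_ofFn' _ _).1 (List.mem_of_mem_drop ha)
      exact hqX j w _ (hS.1 j))
  obtain ⟨uv', h4, h5⟩ := hqY _ hS.1 v' hS.2
  refine ⟨ux', uv', h1, h4, h2, ?_⟩
  have h6 : qX.eval w.length ≤ qX.eval (w ++ ux).length := polynomial_eval_mono _ (by simp)
  have h7 : qY.eval w.length ≤ qY.eval (w ++ ux).length := polynomial_eval_mono _ (by simp)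
  have h8 : s * (2 * qX.eval w.length + 1) ≤ s * (2 * qX.eval (w ++ ux).length + 1) := by gcongr
  rw [List.length_ofFn] at h3
  simp [length_pairStr] at h3 h5 h6 h7 h8 ⊢
  omega

/-- Optimality for an upper level can be verified with one more level of the hierarchy than
optimality for the levels below. -/
theorem fp_jointResponse_of_succ (hP : P.PolyTimeData) (hY : P.BottomVerifiable r)
    {U : Str → (Fin s → Vec) × Vec → Set Vec} {i : Fin s} {k : ℕ} (hrk : r ≤ k)
    (hC : FP r (jointChar (P.jointConstraints U i)))
    (hR : FP k (jointChar (P.jointResponse U (i + 1)))) :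
    FP (k + 1) (jointChar (P.jointResponse U i)) := by
  obtain ⟨E, hE, hEF⟩ := hY.exists_eval_rat (hP.polyTime_F i)
  obtain ⟨q, hq⟩ := hP.exists_codes
  -- A certificate codes a competitor: the lower levels react optimally, the constraints of level
  -- `i` hold, the decisions above `i` are repeated code by code, and the objective value is
  -- strictly smaller.
  let chk : (Str × Str × Str) × Str → Bool := fun p =>
    jointChar (P.jointResponse U (i + 1)) (p.1.1, unpairStr p.2) &&
    (jointChar (P.jointConstraints U i) (p.1.1, unpairStr p.2) &&
    (agreeStr i p.1.2.1 (unpairStr p.2).1 && fracLt (E (p.1.1, unpairStr p.2)) (E p.1)))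
  have hchk : FP k chk := by
    have hC' := hC.mono hrk
    have hE' := hE.mono hrk
    fun_prop
  let L : Set Str := {u | ∃ c : Str, c.length ≤ q.eval u.length ∧
    chk (((unpairStr (unpairStr u).1).1, (unpairStr (unpairStr u).1).2, (unpairStr u).2), c) = true}
  have hL : L ∈ SigmaP (k + 1) := mem_sigmaP_succ (chk := fun p =>
    chk (((unpairStr (unpairStr p.1).1).1, (unpairStr (unpairStr p.1).1).2, (unpairStr p.1).2),
      p.2)) (by fun_prop) q fun u => Iff.rfl
  have hLc := SigmaP.charFun hL
  have hC' := hC.mono (hrk.trans (Nat.le_succ k))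
  have hR' := hR.mono (Nat.le_succ k)
  refine FP.jointChar_of_subset (hY.fp.mono (hrk.trans (Nat.le_succ k)))
    (c := fun t => jointChar (P.jointResponse U (i + 1)) t &&
      (jointChar (P.jointConstraints U i) t && !charFun L (jointStr t)))
    (by fun_prop) (fun p hp => hp.1) fun w ux uv x v hx hv hS => ?_
  -- Membership in the domain of level `i` is already part of joint feasibility.
  have hlevel : ∀ p : (Fin s → Vec) × Vec, ((w, p.1), p.2) ∈ P.jointFeasible →
      (p ∈ P.levelFeasible (U w) w i (P.response (U w) w (i + 1)) ↔
        ((w, p.1), p.2) ∈ P.jointResponse U (i + 1) ∧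
        ((w, p.1), p.2) ∈ P.jointConstraints U i) := by
    intro p hp
    simp only [levelFeasible, jointResponse, jointConstraints, Set.mem_ofPred_eq, hp, true_and]
    have := hp.1 i
    tauto
  have hmem : jointStr (w, ux, uv) ∈ L ↔
      ∃ p ∈ P.levelFeasible (U w) w i (P.response (U w) w (i + 1)), (∀ j < i, p.1 j = x j) ∧
        P.F i w p.1 p.2 < P.F i w x v := by
    have hLmem : jointStr (w, ux, uv) ∈ L ↔ ∃ c : Str,
        c.length ≤ q.eval (jointStr (w, ux, uv)).length ∧ chk ((w, ux, uv), c) = true := by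
      simp [L, jointStr]
    rw [hLmem]
    obtain ⟨hpos, hval⟩ := hEF w ux uv x v hx hv hS
    constructor
    · rintro ⟨c, -, hc⟩
      simp only [chk, Bool.and_eq_true] at hc
      obtain ⟨h1, h2, h3, h4⟩ := hc
      obtain ⟨x', v', hx', hv', hR1⟩ := jointChar_eq_true.1 h1
      have hC1 := (jointChar_iff_of_codes hx' hv').1 h2
      obtain ⟨hpos', hval'⟩ := hEF _ _ _ _ _ hx' hv' hR1.1
      refine ⟨(x', v'), (hlevel _ hR1.1).2 ⟨hR1, hC1⟩, fun j hj => ?_, ?_⟩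
      · have h5 := take_eq_of_agreeStr hx hx' (by simp) h3
        have h6 := congrArg (fun l => l[(j : ℕ)]?) h5
        simpa [List.getElem?_take, show (j : ℕ) < i from hj] using h6.symm
      · rw [hval, hval']
        exact (fracLt_iff hpos' hpos).1 h4
    · rintro ⟨⟨x', v'⟩, hp, hagree, hlt⟩
      have hsub := response_subset (U w) w (i := i + 1) i.2 _ hp.2.2
      -- The domains above level `i` are inherited from `x` by agreement, the one at `i` comes from
      -- feasibility, and those below from the response.
      have hS' : ((w, x'), v') ∈ P.jointFeasible := by
        refine ⟨fun j => ?_, hsub.1⟩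
        rcases lt_trichotomy j i with hj | rfl | hj
        · change x' j ∈ _
          rw [show x' j = x j from hagree j hj]
          exact hS.1 j
        · exact hp.1
        · exact hsub.2 j hj
      obtain ⟨ux', uv', hx', hv', h1, h2⟩ := hq w i ux x x' v' hx (fun j hj => hagree j hj) hS'
      obtain ⟨hpos', hval'⟩ := hEF _ _ _ _ _ hx' hv' hS'
      obtain ⟨hR1, hC1⟩ := (hlevel (x', v') hS').1 hp
      refine ⟨pairStr ux' uv', h2.trans (polynomial_eval_mono q ?_), ?_⟩
      · simp [jointStr, length_pairStr]
        omega
      · simp only [chk, unpairStr_pairStr, Bool.and_eq_true]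
        refine ⟨(jointChar_iff_of_codes hx' hv').2 hR1, (jointChar_iff_of_codes hx' hv').2 hC1,
          h1, (fracLt_iff hpos' hpos).2 ?_⟩
        rw [← hval, ← hval']
        exact hlt
  rw [Bool.and_eq_true, Bool.and_eq_true, jointChar_iff_of_codes hx hv,
    jointChar_iff_of_codes hx hv, Bool.not_eq_true', charFun_eq_false, hmem, ← and_assoc,
    ← hlevel (x, v) hS]
  simp only [jointResponse, Set.mem_ofPred_eq, response_of_lt, levelOptimal, hS, true_and]
  push Not
  rfl

/-- Descending induction from the bottom level, where `FP r` suffices; each upper level passed adds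
one level of oracles. -/
theorem fp_jointResponse (hP : P.PolyTimeData) (hY : P.BottomVerifiable r)
    (hL : P.bottom.InSigma r) {U : Str → (Fin s → Vec) × Vec → Set Vec}
    (hC : ∀ i, FP r (jointChar (P.jointConstraints U i))) {i : ℕ} (hi : i ≤ s) :
    FP (r + (s - i)) (jointChar (P.jointResponse U i)) := by
  induction hi using Nat.decreasingInduction with
  | self => simpa using fp_jointResponse_bottom hP hY hL U
  | of_succ i hi ih =>
      rw [show r + (s - i) = r + (s - (i + 1)) + 1 by omega]
      exact fp_jointResponse_of_succ (i := ⟨i, hi⟩) hP hY (by omega) (hC _) ih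

/-- The last existential quantifier is spent on guessing a joint decision that meets the bound.
Optimality is required only from level `1` on, where the test has `s - 1` levels of oracles more
than at the bottom. -/
theorem topProblem_inSigma [NeZero s] (hP : P.PolyTimeData) (hY : P.BottomVerifiable r)
    (hL : P.bottom.InSigma r) {U : Str → (Fin s → Vec) × Vec → Set Vec}
    (hC : ∀ i, FP r (jointChar (P.jointConstraints U i))) :
    (P.topProblem U).InSigma (r + s) := by
  have hs : 1 ≤ s := NeZero.one_le
  have hR := fp_jointResponse hP hY hL hC hs
  obtain ⟨E, hE, hEF⟩ := hY.exists_eval_rat (hP.polyTime_F 0)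
  obtain ⟨q, hq⟩ := hP.exists_codes
  have hrk : r ≤ r + (s - 1) := by omega
  have hC' := (hC 0).mono hrk
  have hE' := hE.mono hrk
  -- Above the top-most level there is nothing to agree with. Any family can serve as reference, and
  -- its fixed code only adds a constant to the length bound.
  obtain ⟨u₀, hu₀⟩ := Coding.exists_code (fun _ : Fin s => ([] : Vec))
  unfold OptProblem.InSigma
  rw [show r + s = r + (s - 1) + 1 by omega]
  -- The first two tests reject inputs that are not codes of an instance with a rational bound; the
  -- others verify the guessed decision.
  refine mem_sigmaP_succ (k := r + (s - 1)) (chk := fun p =>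
    decide (p.1 = pairStr (unpairStr p.1).1 (enc (parseFrac (unpairStr p.1).2))) &&
    (!decide ((parseFrac (unpairStr p.1).2).2 = 0) &&
    (jointChar (P.jointResponse U 1) ((unpairStr p.1).1, unpairStr p.2) &&
    (jointChar (P.jointConstraints U 0) ((unpairStr p.1).1, unpairStr p.2) &&
    !fracLt (parseFrac (unpairStr p.1).2) (E ((unpairStr p.1).1, unpairStr p.2))))))
    (by fun_prop) (q.comp (.X + (u₀.length : Polynomial ℕ))) fun u => ?_
  constructor
  · rintro ⟨⟨_, γ⟩, ⟨-, ⟨x, v⟩, hp, hF⟩, w, uγ, rfl, hγ, rfl⟩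
    obtain ⟨b, hb, rfl, rfl⟩ := codes_rat_iff.1 hγ
    have hsub := response_subset (U w) w hs _ hp.2.2
    have hS : ((w, x), v) ∈ P.jointFeasible := by
      refine ⟨fun j => ?_, hsub.1⟩
      by_cases hj : j = 0
      · subst hj; exact hp.1
      · exact hsub.2 j (Nat.one_le_iff_ne_zero.2 fun h => hj (Fin.ext h))
    obtain ⟨ux, uv, hx, hv, -, hlen⟩ := hq w 0 u₀ _ x v hu₀ (by simp) hS
    obtain ⟨hpos, hval⟩ := hEF _ _ _ _ _ hx hv hS
    refine ⟨pairStr ux uv, hlen.trans ?_, ?_⟩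
    · rw [Polynomial.eval_comp]
      refine polynomial_eval_mono q ?_
      simp [length_pairStr]
      omega
    · simp only [unpairStr_pairStr, parseFrac_enc, Bool.and_eq_true, decide_true, true_and,
        Bool.not_eq_true', decide_eq_false_iff_not]
      refine ⟨hb.ne', (jointChar_iff_of_codes hx hv).2 ⟨hS, hp.2.2⟩,
        (jointChar_iff_of_codes hx hv).2 ⟨hS, hp.2.1⟩, ?_⟩
      rw [← Bool.not_eq_true, fracLt_iff hb hpos, not_lt, ← hval]
      exact hF
  · rintro ⟨c, -, hc⟩
    simp only [Bool.and_eq_true, decide_eq_true_eq, Bool.not_eq_true',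
      decide_eq_false_iff_not] at hc
    obtain ⟨hu, hb, hR1, hC1, hF⟩ := hc
    obtain ⟨x, v, hx, hv, hR1⟩ := jointChar_eq_true.1 hR1
    have hC1 := (jointChar_iff_of_codes hx hv).1 hC1
    obtain ⟨hpos, hval⟩ := hEF _ _ _ _ _ hx hv hR1.1
    rw [← Bool.not_eq_true, fracLt_iff (Nat.pos_of_ne_zero hb) hpos, not_lt, ← hval] at hF
    exact ⟨(_, _), ⟨trivial, (x, v), ⟨hR1.1.1 0, hC1.2, hR1.2⟩, hF⟩, _, _, rfl,
      codes_fracVal (Nat.pos_of_ne_zero hb), hu⟩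

end MultilevelProblem

theorem theorem4 (s r : ℕ) [NeZero s] (P : MultilevelProblem s) (hP : P.PolyTimeData)
    (hY : P.BottomVerifiable r)
    {κ : Type} [Coding κ] (H : κ → Vec → ℚ) (hG : P.NegConstraintsIn H)
    (hL : P.bottom.InSigmaStar r H) :
    P.gnormp.InSigma (r + s) ∧ P.canonical.InSigma (r + s) :=
  ⟨MultilevelProblem.topProblem_inSigma hP hY hL.1
    (MultilevelProblem.fp_jointConstraints_nearOptimal hP hY hG hL.2),
  MultilevelProblem.topProblem_inSigma hP hY hL.1
    (MultilevelProblem.fp_jointConstraints_canonical hP hY)⟩
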